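/- **Setting.** Let $M$, $P$ be smooth manifolds (Hausdorff, second countable, without boundary), $\dim M=n\ge 1$, $\dim P=m+n$, and let $\alpha:P\to M$ be a smooth (locally trivial) fiber bundle. Put $A=C^\infty(P)$; vector fields on $P$ are derivations of $A$, they form the $A$-module $\mathrm D(P)$, and $k$-forms are alternating $A$-multilinear functions $\mathrm D(P)^k\to A$, forming $\Lambda^k(P)$. Let $V\mathrm D\subset \mathrm D(P)$ be the module of vertical vector fields, i.e. those annihilating $\alpha^*C^\infty(M)$. * $\Lambda_p^k\subset\Lambda^k(P)$ is the module of $k$-forms which vanish whenever at least $k-p+1$ of their arguments are vertical (so $\Lambda^k_p=0$ if $k<p$). Put $\overline\Lambda{}^p=\Lambda_p^p$, $V\!\Lambda^k=\Lambda^k(P)/\Lambda_1^k$ and $E_0^{p,q}=\Lambda_p^{p+q}/\Lambda_{p+1}^{p+q}$. An element of $V\!\Lambda^q\otimes_A\overline\Lambda{}^p$ is read as a skew-symmetric form on $V\mathrm D$ with values in $\overline\Lambda{}^p$ by $(\sigma\otimes\rho)(Y_1,\dots,Y_q)=\sigma(Y_1,\dots,Y_q)\rho$. * $C$ is the set of connections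 in $\alpha$, i.e. of splittings $\mathrm D(P)=V\mathrm D\oplus H_\nabla\mathrm D$, given by their $A$-linear horizontal projectors $h_\nabla$. It is an affine space over $\overline\Lambda{}^1\otimes_AV\mathrm D$, with $h_{\nabla+\eta\otimes Y}=h_\nabla+\eta(\cdot)Y$. * $\underline\Omega^0=\Omega^0=\overline\Lambda{}^{n-1}$, and for $k\ge0$, $\underline\Omega^{k+1}=V\!\Lambda^{k+1}\otimes_A\overline\Lambda{}^{n-1}$, each element of which is regarded as a linear map $\overline\Lambda{}^1\otimes_AV\mathrm D\to V\!\Lambda^k\otimes_A\overline\Lambda{}^n$ by $(\sigma\otimes\rho)(\eta\otimes Y)=(-1)^k\,i_Y\sigma\otimes\eta\rho$. $\Omega^{k+1}$ is the $A$-module of affine maps $\vartheta:C\to V\!\Lambda^k\otimes_A\overline\Lambda{}^n$ whose linear part $\underline\vartheta$ lies in $\underline\Omega^{k+1}$ (affine forms). For $q=0$ put $\underline\vartheta=\vartheta$. * $\Omega_0^q=\{\vartheta\in\Omega^q:\underline\vartheta=0\}$. **Theorem.** The linear part of an affine form is a unique element of $\underline\Omega^q$, and $\vartheta\mapsto\underline\vartheta$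 is an $A$-linear map $\Omega^q\to\underline\Omega^q$. For every $q\ge0$ there are canonical isomorphisms of $A$-modules $$\iota_{0,q}:\Lambda_n^{q+n-1}\to\Omega_0^q,\qquad \iota_q:\Lambda_{n-1}^{q+n-1}\to\Omega^q,\qquad \underline\iota{}_q:E_0^{n-1,q}\to\underline\Omega^q .$$ They are uniquely determined by the following formulas. For $q>0$, vertical $Y_1,Y_2,\dots$, arbitrary vector fields $X_1,X_2,\dots$ and every connection $\nabla$, $$\iota_{0,q}(\omega)(\nabla)(Y_1,\dots,Y_{q-1})(X_1,\dots,X_n)=\omega(Y_1,\dots,Y_{q-1},X_1,\dots,X_n),$$ $$\iota_q(\omega)(\nabla)(Y_1,\dots,Y_{q-1})(X_1,\dots,X_n)=\omega(Y_1,\dots,Y_{q-1},h_\nabla X_1,\dots,h_\nabla X_n)$$ (that is, $\iota_q(\omega)(\nabla)$ is the component of $\omega$ in $V\!\Lambda^{q-1}\otimes_A\overline\Lambda{}^n$ with respect to the splitting defined by $\nabla$), and $$\underline\iota{}_q(\omega+\Lambda_n^{q+n-1})(Y_1,\dots,Y_q)(X_1,\dots,X_{n-1})=\omega(Y_1,\dots,Y_q,X_1,\dots,X_{n-1}).$$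 For $q=0$, $\iota_0$ and $\underline\iota{}_0$ are the identity of $\overline\Lambda{}^{n-1}$ (note that $\Lambda_n^{n-1}=0$), and $\iota_{0,0}=0$. In every degree $q$ the diagram $$\begin{array}{ccccccccc}0&\to&\Lambda_n^{q+n-1}&\to&\Lambda_{n-1}^{q+n-1}&\to&E_0^{n-1,q}&\to&0\\&&\downarrow{\scriptstyle\iota_{0,q}}&&\downarrow{\scriptstyle\iota_q}&&\downarrow{\scriptstyle\underline\iota{}_q}&&\\0&\to&\Omega_0^q&\to&\Omega^q&\to&\underline\Omega^q&\to&0\end{array}$$ (inclusions; the quotient map and the linear part) commutes, and its rows are exact. -/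

import Mathlib

open scoped Manifold ContDiff TensorProduct

noncomputable section

namespace AffineForms

/-! ### Forms on a module of vector fields with a distinguished vertical submodule

`A` stands for the algebra of smooth functions on `P`, `D` for the `A`-module of vector fields on
`P`, and `V` for its submodule of vertical vector fields. -/

section Algebra

variable {A : Type*} [CommRing A] {D : Type*} [AddCommGroup D] [Module A D]

variable (A D) in
/-- Differential `k`-forms: alternating `A`-multilinear functions of `k` vector fields. -/
def Form (k : ℕ) : Type _ := D [⋀^Fin k]→ₗ[A] A

instance Form.instAddCommGroup (k : ℕ) : AddCommGroup (Form A D k) :=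
  inferInstanceAs (AddCommGroup (D [⋀^Fin k]→ₗ[A] A))

instance Form.instModule (k : ℕ) : Module A (Form A D k) :=
  inferInstanceAs (Module A (D [⋀^Fin k]→ₗ[A] A))

instance Form.instFunLike (k : ℕ) : FunLike (Form A D k) (Fin k → D) A :=
  inferInstanceAs (FunLike (D [⋀^Fin k]→ₗ[A] A) (Fin k → D) A)

theorem Form.add_apply {k : ℕ} (v w : Form A D k) (X : Fin k → D) : (v + w) X = v X + w X := rfl

theorem Form.smul_apply {k : ℕ} (a : A) (w : Form A D k) (X : Fin k → D) :
    (a • w) X = a * w X := rfl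

@[ext]
theorem Form.ext {k : ℕ} {v w : Form A D k} (h : ∀ X, v X = w X) : v = w :=
  AlternatingMap.ext h

/-- `Λ_p^k`: the `k`-forms which vanish as soon as at least `k - p + 1` of their arguments are
vertical (in particular only the zero form if `k < p`). -/
def filtration (V : Submodule A D) (p k : ℕ) : Submodule A (Form A D k) where
  carrier := {w | ∀ s : Finset (Fin k), k < p + s.card →
    ∀ X : Fin k → D, (∀ i ∈ s, X i ∈ V) → w X = 0}
  add_mem' {w₁ w₂} h₁ h₂ s hs X hX := by
    rw [Form.add_apply, h₁ s hs X hX, h₂ s hs X hX, add_zero]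
  zero_mem' _ _ _ _ := rfl
  smul_mem' a w h s hs X hX := by
    rw [Form.smul_apply, h s hs X hX, mul_zero]

theorem filtration_succ_le (V : Submodule A D) (p k : ℕ) :
    filtration V (p + 1) k ≤ filtration V p k :=
  fun _ h s hs X hX => h s (by omega) X hX

/-- The column quotient `E_0^{p,q} = Λ_p^{q+p} / Λ_{p+1}^{q+p}`. -/
abbrev E0 (V : Submodule A D) (p q : ℕ) : Type _ :=
  filtration V p (q + p) ⧸ (filtration V (p + 1) (q + p)).submoduleOf (filtration V p (q + p))

/-- Vertical forms: the quotient of all `k`-forms by `Λ_1^k`. -/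
abbrev VForm (V : Submodule A D) (k : ℕ) : Type _ := Form A D k ⧸ filtration V 1 k

/-- Horizontal forms: `Λ_p^p`. -/
abbrev HForm (V : Submodule A D) (p : ℕ) : Type _ := filtration V p p

theorem HForm.apply_eq_zero {V : Submodule A D} {p : ℕ} (ρ : HForm V p) (X : Fin p → D)
    (i : Fin p) (hi : X i ∈ V) : ρ.1 X = 0 :=
  ρ.2 {i} (by simp) X (by simpa using hi)

/-- Evaluation of a vertical form on vertical vector fields. -/
def VForm.eval {V : Submodule A D} {k : ℕ} (Y : Fin k → V) : VForm V k →ₗ[A] A :=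
  (filtration V 1 k).liftQ
    { toFun := fun w => w (fun i => (Y i : D))
      map_add' := fun _ _ => rfl
      map_smul' := fun _ _ => rfl }
    (fun w h => h Finset.univ (by simp) _ (fun i _ => (Y i).2))

/-- Evaluation of a horizontal form on vector fields. -/
def HForm.eval (V : Submodule A D) {p : ℕ} (X : Fin p → D) : HForm V p →ₗ[A] A where
  toFun ρ := ρ.1 X
  map_add' _ _ := rfl
  map_smul' _ _ := rfl

/-- The interpretation of an element of the tensor product of vertical `q`-forms and horizontal
`p`-forms as a skew-symmetric form on vertical vector fields with values in horizontal `p`-forms: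
`(σ ⊗ ρ)(Y_1, …, Y_q)(X_1, …, X_p) = σ(Y_1, …, Y_q) ρ(X_1, …, X_p)`. -/
def evalTensor {V : Submodule A D} {q p : ℕ} (Y : Fin q → V) (X : Fin p → D) :
    VForm V q ⊗[A] HForm V p →ₗ[A] A :=
  LinearMap.mul' A A ∘ₗ TensorProduct.map (VForm.eval Y) (HForm.eval V X)

/-- Insertion `i_Y` of a vertical vector field `Y` into the first place of a vertical form. -/
def insertVert (V : Submodule A D) (k : ℕ) : V →ₗ[A] VForm V (k + 1) →ₗ[A] VForm V k where
  toFun Y := (filtration V 1 (k + 1)).mapQ (filtration V 1 k)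
    { toFun := fun w => AlternatingMap.curryLeft w (Y : D)
      map_add' := fun _ _ => rfl
      map_smul' := fun _ _ => rfl }
    (by
      intro w h s hs X hX
      have hs' : s = Finset.univ := by
        rw [← Finset.card_eq_iff_eq_univ, Fintype.card_fin]
        have := s.card_le_univ
        rw [Fintype.card_fin] at this
        omega
      subst hs'
      refine h Finset.univ (by simp) (Matrix.vecCons (Y : D) X) (fun i _ => ?_)
      refine Fin.cases ?_ (fun j => ?_) i
      · exact Y.2
      · exact hX j (Finset.mem_univ j))
  map_add' Y₁ Y₂ := by
    ext w : 2
    exact congrArg (Submodule.Quotient.mk) (map_add (AlternatingMap.curryLeft w) (Y₁ : D) (Y₂ : D))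
  map_smul' a Y := by
    ext w : 2
    exact congrArg (Submodule.Quotient.mk) (map_smul (AlternatingMap.curryLeft w) a (Y : D))

theorem update_fin_one (X : D) :
    Function.update (fun _ : Fin 1 => (0 : D)) 0 X = fun _ => X := by
  ext i; simp [Subsingleton.elim i 0]

/-- A horizontal `1`-form as a linear functional on vector fields. -/
def HForm.toLin (V : Submodule A D) : HForm V 1 →ₗ[A] D →ₗ[A] A where
  toFun η :=
    { toFun := fun X => η.1 (fun _ => X)
      map_add' := fun X Y => by
        have h := AlternatingMap.map_update_add η.1 (fun _ : Fin 1 => (0 : D)) 0 X Y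
        rwa [update_fin_one, update_fin_one, update_fin_one] at h
      map_smul' := fun a X => by
        have h := AlternatingMap.map_update_smul η.1 (fun _ : Fin 1 => (0 : D)) 0 a X
        rwa [update_fin_one, update_fin_one] at h }
  map_add' _ _ := rfl
  map_smul' _ _ := rfl

/-- The wedge product `η ρ` of a `1`-form `η` with an `r`-form `ρ`:
`(η ρ)(X_0, …, X_r) = ∑ i, (-1)^i η(X_i) ρ(X_0, …, X_{i-1}, X_{i+1}, …, X_r)`. -/
def wedgeForm {r : ℕ} (η : D →ₗ[A] A) (ρ : Form A D r) : Form A D (r + 1) :=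
  AlternatingMap.alternatizeUncurryFin (η.smulRight (show D [⋀^Fin r]→ₗ[A] A from ρ))

theorem wedgeForm_apply {r : ℕ} (η : D →ₗ[A] A) (ρ : Form A D r) (X : Fin (r + 1) → D) :
    wedgeForm η ρ X = ∑ i : Fin (r + 1), (-1) ^ (i : ℕ) * (η (X i) * ρ (i.removeNth X)) := by
  refine (AlternatingMap.alternatizeUncurryFin_apply _ _).trans ?_
  refine Finset.sum_congr rfl (fun i _ => ?_)
  change (-1 : ℤ) ^ (i : ℕ) • (η (X i) * ρ (i.removeNth X)) = _
  rw [zsmul_eq_mul]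
  push_cast
  rfl

/-- The wedge product of a horizontal `1`-form with a horizontal `r`-form. -/
def wedge (V : Submodule A D) (r : ℕ) : HForm V 1 →ₗ[A] HForm V r →ₗ[A] HForm V (r + 1) :=
  LinearMap.mk₂ A
    (fun η ρ => ⟨wedgeForm (HForm.toLin V η) ρ.1, by
      intro s hs X hX
      rw [wedgeForm_apply]
      refine Finset.sum_eq_zero (fun i _ => ?_)
      obtain ⟨j, hj⟩ : s.Nonempty := by
        rw [← Finset.card_pos]; omega
      by_cases hij : j = i
      · subst hij
        have h0 : HForm.toLin V η (X j) = 0 :=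
          HForm.apply_eq_zero η (fun _ => X j) 0 (hX j hj)
        rw [h0, zero_mul, mul_zero]
      · obtain ⟨l, hl⟩ := Fin.exists_succAbove_eq hij
        rw [HForm.apply_eq_zero ρ (i.removeNth X) l
          (by rw [Fin.removeNth_apply, hl]; exact hX j hj), mul_zero, mul_zero]⟩)
    (fun η₁ η₂ ρ => by
      apply Subtype.ext; ext X
      simp [wedgeForm_apply, Form.add_apply, add_mul, mul_add, Finset.sum_add_distrib])
    (fun a η ρ => by
      apply Subtype.ext; ext X
      simp [wedgeForm_apply, Form.smul_apply, Finset.mul_sum, mul_left_comm, mul_assoc])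
    (fun η ρ₁ ρ₂ => by
      apply Subtype.ext; ext X
      simp [wedgeForm_apply, Form.add_apply, mul_add, Finset.sum_add_distrib])
    (fun a η ρ => by
      apply Subtype.ext; ext X
      simp [wedgeForm_apply, Form.smul_apply, Finset.mul_sum, mul_left_comm])

/-- An (Ehresmann) connection: a splitting of the module of vector fields into vertical and
horizontal ones, given by the horizontal projector (its kernel is `V`, and its range is the
module of horizontal vector fields). -/
structure Connection (V : Submodule A D) where
  /-- The horizontal projector. -/
  hor : D →ₗ[A] D
  hor_vertical : ∀ Y ∈ V, hor Y = 0
  sub_hor_mem : ∀ X : D, X - hor X ∈ V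

/-- The vector valued `1`-form `X ↦ η(X) Y` given by `η ⊗ Y`. -/
def toEnd (V : Submodule A D) : HForm V 1 ⊗[A] V →ₗ[A] D →ₗ[A] D :=
  TensorProduct.lift (LinearMap.mk₂ A
    (fun η Y => (HForm.toLin V η).smulRight (Y : D))
    (fun η₁ η₂ Y => by ext X; simp [add_smul])
    (fun a η Y => by ext X; simp [mul_smul])
    (fun η Y₁ Y₂ => by ext X; simp)
    (fun a η Y => by ext X; simp [smul_smul, mul_comm]))

theorem toEnd_vertical (V : Submodule A D) (Z : HForm V 1 ⊗[A] V) (Y : D) (hY : Y ∈ V) :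
    toEnd V Z Y = 0 := by
  induction Z with
  | zero => simp
  | tmul η Y' =>
    have h0 : HForm.toLin V η Y = 0 := HForm.apply_eq_zero η (fun _ => Y) 0 hY
    simp [toEnd, h0]
  | add Z₁ Z₂ h₁ h₂ => simp [h₁, h₂]

theorem toEnd_mem (V : Submodule A D) (Z : HForm V 1 ⊗[A] V) (X : D) : toEnd V Z X ∈ V := by
  induction Z with
  | zero => simp
  | tmul η Y' => simpa [toEnd] using V.smul_mem _ Y'.2
  | add Z₁ Z₂ h₁ h₂ => simpa using V.add_mem h₁ h₂

/-- The affine structure on connections: `∇ + Z` for `Z` a vertical vector valued horizontal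
`1`-form. -/
def Connection.translate {V : Submodule A D} (c : Connection V) (Z : HForm V 1 ⊗[A] V) :
    Connection V where
  hor := c.hor + toEnd V Z
  hor_vertical Y hY := by simp [c.hor_vertical Y hY, toEnd_vertical V Z Y hY]
  sub_hor_mem X := by
    have h := V.sub_mem (c.sub_hor_mem X) (toEnd_mem V Z X)
    rwa [sub_sub] at h

/-- `φ` is an affine map on the space of connections, with linear part `L`. -/
def HasLinearPart {V : Submodule A D} {W : Type*} [AddCommGroup W] [Module A W]
    (φ : Connection V → W) (L : HForm V 1 ⊗[A] V →ₗ[A] W) : Prop :=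
  ∀ (c : Connection V) (Z : HForm V 1 ⊗[A] V), φ (c.translate Z) = φ c + L Z

/-- The map from `VΛ^{k+1} ⊗ Λ̄^r` to the linear maps `Λ̄^1 ⊗ V → VΛ^k ⊗ Λ̄^{r+1}`, which sends
`σ ⊗ ρ` to `η ⊗ Y ↦ (-1)^k (i_Y σ) ⊗ (η ρ)`. -/
def embed (V : Submodule A D) (r k : ℕ) :
    VForm V (k + 1) ⊗[A] HForm V r →ₗ[A]
      (HForm V 1 ⊗[A] V →ₗ[A] VForm V k ⊗[A] HForm V (r + 1)) :=
  (-1 : A) ^ k • LinearMap.flip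
    (TensorProduct.homTensorHomMap (RingHom.id A) _ _ _ _ ∘ₗ
      TensorProduct.map (insertVert V k) (wedge V r) ∘ₗ
        (TensorProduct.comm A (HForm V 1) V).toLinearMap)

/-- For a base of dimension `r + 1`: affine maps from connections to `VΛ^k ⊗ Λ̄^{r+1}` whose linear
part comes from `VΛ^{k+1} ⊗ Λ̄^r`. -/
def affineFormSucc (V : Submodule A D) (r k : ℕ) :
    Submodule A (Connection V → VForm V k ⊗[A] HForm V (r + 1)) where
  carrier := {φ | ∃ s : VForm V (k + 1) ⊗[A] HForm V r, HasLinearPart φ (embed V r k s)}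
  add_mem' := by
    rintro φ₁ φ₂ ⟨s₁, h₁⟩ ⟨s₂, h₂⟩
    refine ⟨s₁ + s₂, fun c Z => ?_⟩
    rw [Pi.add_apply, Pi.add_apply, h₁ c Z, h₂ c Z, map_add, LinearMap.add_apply]
    abel
  zero_mem' := ⟨0, fun c Z => by simp⟩
  smul_mem' := by
    rintro a φ ⟨s, h⟩
    refine ⟨a • s, fun c Z => ?_⟩
    rw [Pi.smul_apply, Pi.smul_apply, h c Z, map_smul, LinearMap.smul_apply, smul_add]

/-- `Ω̲^q`, for a base of dimension `r + 1`: it is `Λ̄^r` if `q = 0`, and `VΛ^q ⊗ Λ̄^r` if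
`q > 0`. -/
def LinForm (V : Submodule A D) (r : ℕ) : ℕ → Type _
  | 0 => HForm V r
  | k + 1 => VForm V (k + 1) ⊗[A] HForm V r

instance LinForm.instAddCommGroup (V : Submodule A D) (r : ℕ) :
    (q : ℕ) → AddCommGroup (LinForm V r q)
  | 0 => inferInstanceAs (AddCommGroup (HForm V r))
  | k + 1 => inferInstanceAs (AddCommGroup (VForm V (k + 1) ⊗[A] HForm V r))

instance LinForm.instModule (V : Submodule A D) (r : ℕ) :
    (q : ℕ) → Module A (LinForm V r q)
  | 0 => inferInstanceAs (Module A (HForm V r))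
  | k + 1 => inferInstanceAs (Module A (VForm V (k + 1) ⊗[A] HForm V r))

/-- `Ω^q`, the affine `q`-forms, for a base of dimension `r + 1`: it is `Λ̄^r` if `q = 0`, and for
`q > 0` it consists of the affine maps from connections to `VΛ^{q-1} ⊗ Λ̄^{r+1}` whose linear part
lies in `Ω̲^q`. -/
def AffForm (V : Submodule A D) (r : ℕ) : ℕ → Type _
  | 0 => HForm V r
  | k + 1 => affineFormSucc V r k

instance AffForm.instAddCommGroup (V : Submodule A D) (r : ℕ) :
    (q : ℕ) → AddCommGroup (AffForm V r q)
  | 0 => inferInstanceAs (AddCommGroup (HForm V r))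
  | k + 1 => inferInstanceAs (AddCommGroup (affineFormSucc V r k))

instance AffForm.instModule (V : Submodule A D) (r : ℕ) :
    (q : ℕ) → Module A (AffForm V r q)
  | 0 => inferInstanceAs (Module A (HForm V r))
  | k + 1 => inferInstanceAs (Module A (affineFormSucc V r k))

/-- `s` is the linear part of the affine form `θ` (for `q = 0`, `Ω^0 = Ω̲^0` and the projection is
the identity). -/
def IsLinPart (V : Submodule A D) (r : ℕ) : (q : ℕ) → AffForm V r q → LinForm V r q → Prop
  | 0, (θ : HForm V r), (s : HForm V r) => θ = s
  | k + 1, (θ : affineFormSucc V r k), (s : VForm V (k + 1) ⊗[A] HForm V r) =>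
      HasLinearPart θ.1 (embed V r k s)

theorem IsLinPart.zero (V : Submodule A D) (r : ℕ) : (q : ℕ) → IsLinPart V r q 0 0
  | 0 => rfl
  | k + 1 => fun c Z => by
      change (0 : VForm V k ⊗[A] HForm V (r + 1)) =
        0 + embed V r k (0 : VForm V (k + 1) ⊗[A] HForm V r) Z
      rw [map_zero, LinearMap.zero_apply, add_zero]

theorem IsLinPart.add (V : Submodule A D) (r : ℕ) : (q : ℕ) → ∀ {θ₁ θ₂ : AffForm V r q}
    {s₁ s₂ : LinForm V r q}, IsLinPart V r q θ₁ s₁ → IsLinPart V r q θ₂ s₂ →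
      IsLinPart V r q (θ₁ + θ₂) (s₁ + s₂)
  | 0, _, _, _, _, h₁, h₂ => congrArg₂ (fun a b : HForm V r => a + b) h₁ h₂
  | k + 1, θ₁, θ₂, s₁, s₂, h₁, h₂ => fun c Z => by
      change θ₁.1 (c.translate Z) + θ₂.1 (c.translate Z) = (θ₁.1 c + θ₂.1 c) +
        embed V r k ((s₁ : VForm V (k + 1) ⊗[A] HForm V r) + s₂) Z
      rw [h₁ c Z, h₂ c Z]
      refine (add_add_add_comm _ _ _ _).trans (congrArg _ ?_)
      exact (congrArg (fun L => L Z) (map_add (embed V r k) s₁ s₂)).symm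

theorem IsLinPart.smul (V : Submodule A D) (r : ℕ) : (q : ℕ) → ∀ (a : A) {θ : AffForm V r q}
    {s : LinForm V r q}, IsLinPart V r q θ s → IsLinPart V r q (a • θ) (a • s)
  | 0, a, _, _, h => congrArg (fun b : HForm V r => a • b) h
  | k + 1, a, θ, s, h => fun c Z => by
      change a • θ.1 (c.translate Z) = a • θ.1 c +
        embed V r k (a • (s : VForm V (k + 1) ⊗[A] HForm V r)) Z
      rw [h c Z]
      refine (smul_add _ _ _).trans (congrArg _ ?_)
      exact (congrArg (fun L => L Z) (map_smul (embed V r k) a s)).symm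

/-- `Ω_0^q`: the affine `q`-forms with zero linear part. -/
def affForm0 (V : Submodule A D) (r q : ℕ) : Submodule A (AffForm V r q) where
  carrier := {θ | IsLinPart V r q θ 0}
  add_mem' h₁ h₂ := by
    have h := IsLinPart.add V r q h₁ h₂
    rwa [add_zero] at h
  zero_mem' := IsLinPart.zero V r q
  smul_mem' a _ h := by
    have h' := IsLinPart.smul V r q a h
    rwa [smul_zero] at h'

/-- The element `s` of `Ω̲^q` corresponds to the form `w` in `Λ_r^{q+r}`: as a skew-symmetric form
on vertical vector fields, `s(Y_1, …, Y_q) = i_{Y_q} ⋯ i_{Y_1} w`. -/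
def LinCorresponds (V : Submodule A D) (r : ℕ) :
    (q : ℕ) → Form A D (q + r) → LinForm V r q → Prop
  | 0, w, (s : HForm V r) => ∀ X : Fin r → D, s.1 X = w (Fin.append Fin.elim0 X)
  | k + 1, w, (s : VForm V (k + 1) ⊗[A] HForm V r) => ∀ (Y : Fin (k + 1) → V) (X : Fin r → D),
      evalTensor Y X s = w (Fin.append (fun i => (Y i : D)) X)

/-- The affine form `θ` corresponds to the form `w` in `Λ_r^{q+r}`: for `q > 0` and every
connection `∇`, the value `θ(∇)` is the component of `w` in `VΛ^{q-1} ⊗ Λ̄^{r+1}` with respect to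
the splitting of vector fields into vertical and `∇`-horizontal ones. -/
def AffCorresponds (V : Submodule A D) (r : ℕ) :
    (q : ℕ) → Form A D (q + r) → AffForm V r q → Prop
  | 0, w, (θ : HForm V r) => ∀ X : Fin r → D, θ.1 X = w (Fin.append Fin.elim0 X)
  | k + 1, w, (θ : affineFormSucc V r k) =>
      ∀ (c : Connection V) (Y : Fin k → V) (X : Fin (r + 1) → D),
        evalTensor Y X (θ.1 c) =
          w (Fin.append (fun i => (Y i : D)) (fun j => c.hor (X j)) ∘
            Fin.cast (Nat.add_right_comm k 1 r))

/-- The affine form `θ` with zero linear part corresponds to the form `w` in `Λ_{r+1}^{q+r}`: for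
`q > 0` its constant value in `VΛ^{q-1} ⊗ Λ̄^{r+1}` is the skew-symmetric form
`(Y_1, …, Y_{q-1}) ↦ i_{Y_{q-1}} ⋯ i_{Y_1} w` on vertical vector fields. -/
def ZeroCorresponds (V : Submodule A D) (r : ℕ) :
    (q : ℕ) → Form A D (q + r) → AffForm V r q → Prop
  | 0, _, θ => θ = 0
  | k + 1, w, (θ : affineFormSucc V r k) =>
      ∀ (c : Connection V) (Y : Fin k → V) (X : Fin (r + 1) → D),
        evalTensor Y X (θ.1 c) =
          w (Fin.append (fun i => (Y i : D)) X ∘ Fin.cast (Nat.add_right_comm k 1 r))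

end Algebra

/-! ### Fiber bundles -/

section Bundle

variable {r m : ℕ}
  {M : Type*} [TopologicalSpace M] [ChartedSpace (EuclideanSpace ℝ (Fin (r + 1))) M]
  {P : Type*} [TopologicalSpace P] [ChartedSpace (EuclideanSpace ℝ (Fin (m + (r + 1)))) P]

/-- `α : P → M` is a smooth fiber bundle with typical fiber `F`: it is smoothly locally trivial. -/
def IsSmoothFiberBundle (F : Type*) [TopologicalSpace F]
    [ChartedSpace (EuclideanSpace ℝ (Fin m)) F]
    (α : C^∞⟮𝓡 (m + (r + 1)), P; 𝓡 (r + 1), M⟯) : Prop :=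
  ∀ x : M, ∃ e : Bundle.Trivialization F α, x ∈ e.baseSet ∧
    ContMDiffOn (𝓡 (m + (r + 1))) ((𝓡 (r + 1)).prod (𝓡 m)) ∞ e.toOpenPartialHomeomorph e.source ∧
    ContMDiffOn ((𝓡 (r + 1)).prod (𝓡 m)) (𝓡 (m + (r + 1))) ∞ e.toOpenPartialHomeomorph.symm
      e.target

variable (m r P) in
/-- The algebra of smooth functions on `P`. -/
abbrev SmoothFun : Type _ := C^∞⟮𝓡 (m + (r + 1)), P; ℝ⟯

variable (m r P) in
/-- Vector fields on `P`: the derivations of the algebra of smooth functions. -/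
abbrev VectorFields : Type _ := Derivation ℝ (SmoothFun r m P) (SmoothFun r m P)

/-- The vertical vector fields: those which annihilate the functions pulled back from the base. -/
def vertical (α : C^∞⟮𝓡 (m + (r + 1)), P; 𝓡 (r + 1), M⟯) :
    Submodule (SmoothFun r m P) (VectorFields r m P) where
  carrier := {X | ∀ f : C^∞⟮𝓡 (r + 1), M; ℝ⟯, X (f.comp α) = 0}
  add_mem' {X Y} hX hY f := by rw [Derivation.add_apply, hX f, hY f, add_zero]
  zero_mem' _ := rfl
  smul_mem' a X hX f := by rw [Derivation.smul_apply, hX f, smul_zero]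

end Bundle

end AffineForms

end

open AffineForms

/-! Write n = r + 1 for the dimension of the base. A form w in Λ_r^{q+r} vanishes on q + 1 vertical
arguments. Hence, on q vertical and r arbitrary fields, it sees the latter only modulo V, and its
values are those of an element of Ω̲^q which is zero exactly when w lies in Λ_n^{q+r}. For q > 0,
feed w instead with q - 1 vertical fields and n horizontal projections, and move the connection by η
⊗ Y. Multilinear expansion gives a term linear in η ⊗ Y, which is that same element of Ω̲^q, and
terms with two or more copies of Y, which contain q + 1 vertical arguments and vanish. So the
component is affine in the connection and the right square commutes
(`HorizontalSystem.hasLinearPart`). Connections form a single orbit, so zero linear part means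
constant, and the constants are given by Λ_n^{q+r}. An argument in the style of the five lemma then
yields the isomorphism onto Ω^q.

Two inputs make this rigorous. First, elements of the algebraic tensor product VΛ^q ⊗ Λ̄^p must be
the same as the functions they define. This follows from a finite global dual system η_j, e_j for D
modulo V (`HorizontalSystem`): the Euler identity ∑ η_j ∧ i_{e_j} ρ = p ρ, with p invertible, allows
induction on p. Second, the rank n of D modulo V enters through two vanishing statements: Λ_{n+1}^k
= 0, and a horizontal (n-1)-form killed by all wedge products with horizontal 1-forms is zero. Both
are local and are checked in a `LocalFrame`.

The dual system comes from finitely many functions f_j on the base whose differentials are jointly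
injective at every point (`exists_immersion`). The forms are d(f_j ∘ α). Since α is a submersion,
dual fields exist locally on P, and a partition of unity glues them because the duality condition is
affine in the fields. Vector fields being abstract derivations, Hadamard's lemma reduces statements
about them to differentials at points. -/

namespace AffineForms

/-! ### Filtered forms, dual systems and the tensor product VΛ^q ⊗ Λ̄^p -/

section Algebra

variable {A : Type*} [CommRing A] {D : Type*} [AddCommGroup D] [Module A D] {V : Submodule A D}

theorem removeNth_natAdd_append {α : Type*} {q p : ℕ} (Y : Fin q → α) (X : Fin (p + 1) → α)
    (i : Fin (p + 1)) :
    Fin.removeNth (n := q + p) (Fin.natAdd q i)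
      (Fin.append (m := q) (n := p + 1) Y X) = Fin.append Y (i.removeNth X) := by
  funext l
  refine Fin.addCases (fun l => ?_) (fun l => ?_) l
  · have h : (Fin.succAbove (n := q + p) (Fin.natAdd q i) (Fin.castAdd p l)) =
        Fin.castAdd (p + 1) l := by
      rw [Fin.succAbove_of_castSucc_lt]
      · rfl
      · simp [Fin.lt_def]; omega
    rw [Fin.removeNth_apply, h, Fin.append_left, Fin.append_left]
  · have h : (Fin.succAbove (n := q + p) (Fin.natAdd q i) (Fin.natAdd q l)) =
        Fin.natAdd q (i.succAbove l) := by
      ext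
      simp only [Fin.succAbove, Fin.lt_def, Fin.val_natAdd, Fin.val_castSucc]
      split_ifs <;> simp at * <;> omega
    rw [Fin.removeNth_apply, h, Fin.append_right, Fin.append_right, Fin.removeNth_apply]

/-- A form as a multilinear function of its last arguments, the first ones being fixed. -/
def Form.appendRight {q p : ℕ} (w : Form A D (q + p)) (Y : Fin q → D) :
    MultilinearMap A (fun _ : Fin p => D) A :=
  ((AlternatingMap.toMultilinearMap w).domDomCongr finSumFinEquiv.symm).currySum Y

theorem Form.appendRight_apply {q p : ℕ} (w : Form A D (q + p)) (Y : Fin q → D) (X : Fin p → D) :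
    w.appendRight Y X = w (Fin.append Y X) := by
  refine congrArg w ?_
  funext l
  refine Fin.addCases (fun l => ?_) (fun l => ?_) l <;> simp

/-- The q leading vertical arguments cancel against the q in the degree, so only vertical arguments
in the last n places need counting. -/
theorem filtration.append_eq_zero {p q n : ℕ} {w : Form A D (q + n)}
    (hw : w ∈ filtration V p (q + n)) (Y : Fin q → V) (X : Fin n → D) (s : Finset (Fin n))
    (hs : ∀ i ∈ s, X i ∈ V) (h : n < p + s.card) :
    w (Fin.append (fun i => (Y i : D)) X) = 0 := by
  refine hw (((Finset.univ : Finset (Fin q)).disjSum s).map finSumFinEquiv.toEmbedding) ?_ _ ?_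
  · rw [Finset.card_map, Finset.card_disjSum, Finset.card_univ, Fintype.card_fin]
    omega
  · intro i hi
    obtain ⟨j | j, hj, rfl⟩ := Finset.mem_map.1 hi
    · simp
    · simpa using hs j (by simpa using hj)

/-- Expand X = (X - X') + X' multilinearly: every term containing a difference has more than q
vertical arguments and vanishes. This is the sense in which such forms live on D modulo V in their
last places. -/
theorem filtration.append_congr {p q : ℕ} {w : Form A D (q + p)}
    (hw : w ∈ filtration V p (q + p)) (Y : Fin q → V) (X X' : Fin p → D)
    (h : ∀ i, X i - X' i ∈ V) :
    w (Fin.append (fun i => (Y i : D)) X) = w (Fin.append (fun i => (Y i : D)) X') := by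
  classical
  have e : X = (X - X') + X' := by simp
  rw [← w.appendRight_apply, ← w.appendRight_apply, e, MultilinearMap.map_add_univ,
    Finset.sum_eq_single ∅]
  · simp
  · intro s _ hs
    rw [w.appendRight_apply]
    refine filtration.append_eq_zero hw Y _ s (fun i hi => ?_) ?_
    · rw [Finset.piecewise_eq_of_mem _ _ _ hi]
      exact h i
    · have := Finset.card_pos.2 (Finset.nonempty_iff_ne_empty.2 hs)
      omega
  · simp

/-- If the value of a form in `Λ_p^{q+p}` on `q` vertical and `p` arbitrary vector fields is always
zero, the form lies in `Λ_{p+1}^{q+p}`. -/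
theorem filtration.mem_succ {p q : ℕ} {w : Form A D (q + p)}
    (h : ∀ (Y : Fin q → V) (X : Fin p → D), w (Fin.append (fun i => (Y i : D)) X) = 0) :
    w ∈ filtration V (p + 1) (q + p) := by
  intro s hs X hX
  obtain ⟨t, hts, htc⟩ := Finset.exists_subset_card_eq (s := s) (n := q) (by omega)
  have e₁ : Fin q ≃ t := (finCongr (by simp [htc])).trans t.equivFin.symm
  have e₂ : Fin p ≃ (↥(tᶜ : Finset (Fin (q + p)))) :=
    (finCongr (by simp [Finset.card_compl, htc])).trans (tᶜ).equivFin.symm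
  -- A permutation carrying q of the vertical places to the front; alternation changes the value
  -- only by a sign.
  let σ : Fin (q + p) ≃ Fin (q + p) := finSumFinEquiv.symm.trans
    ((e₁.sumCongr (e₂.trans (Equiv.subtypeEquivRight (by simp)))).trans
      (Equiv.sumCompl (fun i => i ∈ t)))
  have hσ : ∀ i : Fin q, σ (Fin.castAdd p i) ∈ s := fun i => by
    have : σ (Fin.castAdd p i) = e₁ i := by simp [σ]
    rw [this]
    exact hts (e₁ i).2
  have h0 := h (fun i => ⟨X (σ (Fin.castAdd p i)), hX _ (hσ i)⟩) (fun i => X (σ (Fin.natAdd q i)))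
  have e : Fin.append (fun i => X (σ (Fin.castAdd p i))) (fun i => X (σ (Fin.natAdd q i))) =
      X ∘ σ := by
    funext l
    refine Fin.addCases (fun l => ?_) (fun l => ?_) l <;> simp
  have h1 : w (X ∘ σ) = 0 := by rw [← e]; exact h0
  have h2 : w (X ∘ σ) = Equiv.Perm.sign σ • w X := AlternatingMap.map_perm w X σ
  rw [h2] at h1
  rcases Int.units_eq_one_or (Equiv.Perm.sign σ) with hs | hs <;> rw [hs] at h1 <;> simpa using h1

theorem filtration.eq_zero_of_lt {p k : ℕ} (hk : k < p) {w : Form A D k}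
    (hw : w ∈ filtration V p k) : w = 0 := by
  ext X
  exact hw ∅ (by simpa using hk) X (by simp)

/-- Insertion of a vector field into the first place of a horizontal form. -/
def HForm.insert (p : ℕ) (e : D) : HForm V (p + 1) →ₗ[A] HForm V p where
  toFun ρ := ⟨AlternatingMap.curryLeft ρ.1 e, by
    intro s hs X hX
    obtain ⟨j, hj⟩ : s.Nonempty := by
      rw [← Finset.card_pos]; omega
    exact HForm.apply_eq_zero ρ (Matrix.vecCons e X) j.succ (by simpa using hX j hj)⟩
  map_add' _ _ := rfl
  map_smul' _ _ := rfl

theorem HForm.insert_apply {p : ℕ} (e : D) (ρ : HForm V (p + 1)) (X : Fin p → D) :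
    (HForm.insert p e ρ).1 X = ρ.1 (Fin.cons e X) := rfl

/-- Transport of a form along an equality of degrees. -/
def Form.cast {k l : ℕ} (h : k = l) (w : Form A D k) : Form A D l :=
  h ▸ w

theorem Form.cast_apply {k l : ℕ} (h : k = l) (w : Form A D k) (X : Fin l → D) :
    w.cast h X = w (X ∘ Fin.cast h) := by
  subst h; rfl

theorem Form.cast_mem {k l : ℕ} (h : k = l) {w : Form A D k} {p : ℕ} :
    w.cast h ∈ filtration V p l ↔ w ∈ filtration V p k := by
  subst h; rfl

theorem HForm.apply_congr {p : ℕ} (ρ : HForm V p) (X X' : Fin p → D) (h : ∀ i, X i - X' i ∈ V) :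
    ρ.1 X = ρ.1 X' := by
  have key := filtration.append_congr ((Form.cast_mem (Nat.zero_add p).symm).2 ρ.2)
    (Fin.elim0 : Fin 0 → V) X X' h
  have e : (fun i => ((Fin.elim0 : Fin 0 → V) i : D)) = Fin.elim0 := Subsingleton.elim _ _
  rwa [e, Fin.elim0_append, Fin.elim0_append, Form.cast_apply, Form.cast_apply] at key

theorem wedge_apply {p : ℕ} (η : HForm V 1) (ρ : HForm V p) (X : Fin (p + 1) → D) :
    (wedge V p η ρ).1 X = ∑ i : Fin (p + 1),
      (-1) ^ (i : ℕ) * (HForm.toLin V η (X i) * ρ.1 (i.removeNth X)) :=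
  wedgeForm_apply _ _ X

/-- Inserting an argument in the `i`-th place. -/
theorem Form.apply_insertNth {p : ℕ} (w : Form A D (p + 1)) (i : Fin (p + 1)) (e : D)
    (X : Fin p → D) : w (i.insertNth e X) = (-1) ^ (i : ℕ) * w (Fin.cons e X) := by
  refine (AlternatingMap.map_insertNth w i e X).trans ?_
  rw [zsmul_eq_mul]
  push_cast
  rfl

theorem Form.apply_update {p : ℕ} (w : Form A D (p + 1)) (i : Fin (p + 1)) (e : D)
    (X : Fin (p + 1) → D) :
    w (Function.update X i e) = (-1) ^ (i : ℕ) * w (Fin.cons e (i.removeNth X)) := by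
  rw [← Form.apply_insertNth, Fin.insertNth_removeNth]

theorem neg_one_pow_mul_self (i : ℕ) : (-1 : A) ^ i * (-1) ^ i = 1 := by
  rw [← mul_pow]; simp

theorem Form.cons_removeNth {p : ℕ} (w : Form A D (p + 1)) (i : Fin (p + 1)) (X : Fin (p + 1) → D) :
    (-1) ^ (i : ℕ) * w (Fin.cons (X i) (i.removeNth X)) = w X := by
  rw [← Form.apply_update, Function.update_eq_self]

/-- Insertion of a vector field into the first place of a form. -/
def Form.insert {p : ℕ} (e : D) (w : Form A D (p + 1)) : Form A D p :=
  AlternatingMap.curryLeft w e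

theorem Form.sum_apply {p : ℕ} {ι : Type*} (s : Finset ι) (w : ι → Form A D p) (X : Fin p → D) :
    (∑ j ∈ s, w j) X = ∑ j ∈ s, w j X :=
  map_sum (⟨⟨fun v : Form A D p => v X, fun _ _ => rfl⟩, fun _ _ => rfl⟩ : Form A D p →ₗ[A] A) w s

theorem Form.cons_sum {p : ℕ} (w : Form A D (p + 1)) {ι : Type*} (s : Finset ι) (a : ι → A)
    (e : ι → D) (X : Fin p → D) :
    w (Fin.cons (∑ j ∈ s, a j • e j) X) = ∑ j ∈ s, a j * w (Fin.cons (e j) X) := by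
  refine Eq.trans (congrArg (fun f : Form A D p => f X) (map_sum (AlternatingMap.curryLeft w)
    (fun j => a j • e j) s)) ?_
  refine (Form.sum_apply _ _ _).trans (Finset.sum_congr rfl (fun j _ => ?_))
  exact congrArg (fun f : Form A D p => f X) (map_smul (AlternatingMap.curryLeft w) (a j) (e j))

variable (V) in
/-- A dual system for the module of vector fields modulo the vertical ones: horizontal `1`-forms
`form j` and vector fields `vec j` such that every `X` equals `∑ j, form j (X) • vec j` up to a
vertical vector field. -/
structure HorizontalSystem (ι : Type*) [Fintype ι] where
  /-- the horizontal forms -/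
  form : ι → HForm V 1
  /-- the vector fields -/
  vec : ι → D
  sub_mem : ∀ X : D, X - ∑ j, HForm.toLin V (form j) X • vec j ∈ V

namespace HorizontalSystem

variable {ι : Type*} [Fintype ι] (b : HorizontalSystem V ι)

/-- Euler's identity. Each of the p + 1 places contributes ρ once, because ∑ η_j(X_i) e_j agrees
with X_i up to a vertical field, which a horizontal form ignores. -/
theorem sum_wedge_insert {p : ℕ} (ρ : HForm V (p + 1)) :
    ∑ j, wedge V p (b.form j) (HForm.insert p (b.vec j) ρ) = ((p + 1 : ℕ) : A) • ρ := by
  apply Subtype.ext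
  ext X
  have e : (∑ j, wedge V p (b.form j) (HForm.insert p (b.vec j) ρ)).1 X =
      ∑ j, (wedge V p (b.form j) (HForm.insert p (b.vec j) ρ)).1 X :=
    map_sum (HForm.eval V X) _ _
  rw [e]
  simp_rw [wedge_apply, HForm.insert_apply]
  rw [Finset.sum_comm]
  have h : ∀ i : Fin (p + 1), ∑ j, (-1) ^ (i : ℕ) * (HForm.toLin V (b.form j) (X i) *
      ρ.1 (Fin.cons (b.vec j) (i.removeNth X))) = ρ.1 X := fun i => by
    rw [← Finset.mul_sum, ← Form.cons_sum, ← Form.cons_removeNth ρ.1 i X]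
    congr 1
    refine HForm.apply_congr ρ _ _ (fun l => ?_)
    refine Fin.cases ?_ (fun l => ?_) l
    · have := V.neg_mem (b.sub_mem (X i))
      rwa [neg_sub] at this
    · simp
  simp_rw [h]
  simp only [Finset.sum_const, Finset.card_univ, Fintype.card_fin, nsmul_eq_mul]
  rfl

/-- Once p + 1 is invertible, a tensor is recovered from its contractions, whose horizontal degree
is one lower. This drives all inductions on p below. -/
theorem sum_lTensor {q p : ℕ} (t : VForm V q ⊗[A] HForm V (p + 1)) :
    ∑ j, (wedge V p (b.form j)).lTensor (VForm V q)
      ((HForm.insert p (b.vec j)).lTensor (VForm V q) t) = ((p + 1 : ℕ) : A) • t := by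
  induction t with
  | zero => simp
  | tmul σ ρ =>
    simp only [LinearMap.lTensor_tmul]
    rw [← TensorProduct.tmul_sum, sum_wedge_insert, TensorProduct.tmul_smul]
  | add t₁ t₂ h₁ h₂ => simp only [map_add, Finset.sum_add_distrib, h₁, h₂, smul_add]

end HorizontalSystem

theorem evalTensor_tmul {q p : ℕ} (Y : Fin q → V) (X : Fin p → D) (σ : VForm V q) (ρ : HForm V p) :
    evalTensor Y X (σ ⊗ₜ ρ) = VForm.eval Y σ * ρ.1 X := rfl

theorem evalTensor_lTensor_insert {q p : ℕ} (e : D) (Y : Fin q → V) (X : Fin p → D)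
    (t : VForm V q ⊗[A] HForm V (p + 1)) :
    evalTensor Y X ((HForm.insert p e).lTensor (VForm V q) t) = evalTensor Y (Fin.cons e X) t := by
  induction t with
  | zero => simp
  | tmul σ ρ => rw [LinearMap.lTensor_tmul, evalTensor_tmul, evalTensor_tmul, HForm.insert_apply]
  | add t₁ t₂ h₁ h₂ => simp only [map_add, h₁, h₂]

theorem evalTensor_lTensor_wedge {q p : ℕ} (η : HForm V 1) (Y : Fin q → V) (X : Fin (p + 1) → D)
    (t : VForm V q ⊗[A] HForm V p) :
    evalTensor Y X ((wedge V p η).lTensor (VForm V q) t) = ∑ i : Fin (p + 1),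
      (-1) ^ (i : ℕ) * (HForm.toLin V η (X i) * evalTensor Y (i.removeNth X) t) := by
  induction t with
  | zero => simp
  | tmul σ ρ =>
    simp only [LinearMap.lTensor_tmul, evalTensor_tmul, wedge_apply, Finset.mul_sum]
    exact Finset.sum_congr rfl (fun i _ => by ring)
  | add t₁ t₂ h₁ h₂ => simp only [map_add, h₁, h₂, mul_add, Finset.sum_add_distrib]

theorem VForm.eq_zero_of_eval {q : ℕ} {σ : VForm V q} (h : ∀ Y, VForm.eval Y σ = 0) : σ = 0 := by
  obtain ⟨w, rfl⟩ := Submodule.Quotient.mk_surjective _ σ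
  rw [Submodule.Quotient.mk_eq_zero]
  intro s hs X hX
  have hs' : s = Finset.univ := by
    rw [← Finset.card_eq_iff_eq_univ, Fintype.card_fin]
    have := s.card_le_univ
    rw [Fintype.card_fin] at this
    omega
  subst hs'
  exact h (fun i => ⟨X i, hX i (Finset.mem_univ i)⟩)

theorem mem_filtration_zero {k : ℕ} (w : Form A D k) : w ∈ filtration V 0 k := by
  intro s hs
  have := s.card_le_univ
  rw [Fintype.card_fin] at this
  omega

variable (V) in
/-- The constant function `1` as a form of degree zero. -/
def HForm.one : HForm V 0 :=
  ⟨(AlternatingMap.constOfIsEmpty A D (Fin 0) (1 : A) : D [⋀^Fin 0]→ₗ[A] A),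
    mem_filtration_zero _⟩

theorem HForm.one_apply (X : Fin 0 → D) : (HForm.one V).1 X = 1 := rfl

/-- Base case of those inductions: Λ̄^0 is free of rank one, so tensoring with it changes nothing.
-/
theorem exists_tmul_one {q : ℕ} (t : VForm V q ⊗[A] HForm V 0) :
    ∃ σ : VForm V q, t = σ ⊗ₜ HForm.one V := by
  induction t with
  | zero => exact ⟨0, by simp⟩
  | tmul σ ρ =>
    refine ⟨ρ.1 Fin.elim0 • σ, ?_⟩
    rw [TensorProduct.smul_tmul]
    congr 1
    apply Subtype.ext
    ext X
    rw [Subsingleton.elim X Fin.elim0]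
    exact (mul_one _).symm
  | add t₁ t₂ h₁ h₂ =>
    obtain ⟨σ₁, rfl⟩ := h₁
    obtain ⟨σ₂, rfl⟩ := h₂
    exact ⟨σ₁ + σ₂, (TensorProduct.add_tmul _ _ _).symm⟩

variable {ι : Type*} [Fintype ι]

/-- Elements of `VΛ^q ⊗ Λ̄^p` are determined by their values on vector fields. -/
theorem HorizontalSystem.eq_zero_of_evalTensor (b : HorizontalSystem V ι)
    (hA : ∀ p : ℕ, IsUnit ((p + 1 : ℕ) : A)) {q p : ℕ} {t : VForm V q ⊗[A] HForm V p}
    (h : ∀ Y X, evalTensor Y X t = 0) : t = 0 := by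
  induction p with
  | zero =>
    obtain ⟨σ, rfl⟩ := exists_tmul_one t
    rw [VForm.eq_zero_of_eval (σ := σ), TensorProduct.zero_tmul]
    intro Y
    have := h Y Fin.elim0
    rwa [evalTensor_tmul, HForm.one_apply, mul_one] at this
  | succ p ih =>
    -- Up to the unit p + 1, t is assembled from its contractions with e_j; their values are values
    -- of t, so they vanish by induction.
    rw [← (hA p).smul_eq_zero, ← b.sum_lTensor]
    refine Finset.sum_eq_zero (fun j _ => ?_)
    rw [ih (t := (HForm.insert p (b.vec j)).lTensor (VForm V q) t), map_zero]
    intro Y X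
    rw [evalTensor_lTensor_insert, h]

theorem HorizontalSystem.ext_evalTensor (b : HorizontalSystem V ι)
    (hA : ∀ p : ℕ, IsUnit ((p + 1 : ℕ) : A)) {q p : ℕ} {t t' : VForm V q ⊗[A] HForm V p}
    (h : ∀ Y X, evalTensor Y X t = evalTensor Y X t') : t = t' := by
  rw [← sub_eq_zero]
  refine b.eq_zero_of_evalTensor hA (fun Y X => ?_)
  rw [map_sub, h, sub_self]

/-- The component in `VΛ^q ⊗ Λ̄^p` of a form, with respect to a connection. -/
theorem HorizontalSystem.exists_component (b : HorizontalSystem V ι)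
    (hA : ∀ p : ℕ, IsUnit ((p + 1 : ℕ) : A)) (c : Connection V) {q p : ℕ} (w : Form A D (q + p)) :
    ∃ t : VForm V q ⊗[A] HForm V p, ∀ Y X,
      evalTensor Y X t = w (Fin.append (fun i => (Y i : D)) (fun j => c.hor (X j))) := by
  induction p with
  | zero =>
    refine ⟨(Submodule.Quotient.mk w : VForm V q) ⊗ₜ HForm.one V, fun Y X => ?_⟩
    rw [evalTensor_tmul, HForm.one_apply, mul_one, Subsingleton.elim (fun j => c.hor (X j))
      Fin.elim0, Fin.append_elim0]
    rfl
  | succ p ih =>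
    obtain ⟨u, hu⟩ := (hA p).exists_left_inv
    choose t ht using fun j =>
      ih (Form.insert (p := q + p) (c.hor (b.vec j)) w)
    -- Euler's identity dictates the candidate: u inverts p + 1, t j is the component of the
    -- contraction of w with the horizontal part of e_j, and (-1)^q accounts for moving an argument
    -- from the front past the q vertical ones.
    refine ⟨(u * (-1) ^ q) • ∑ j, (wedge V p (b.form j)).lTensor _ (t j), fun Y X => ?_⟩
    have hsum : ∀ X : D, c.hor X = ∑ j, HForm.toLin V (b.form j) X • c.hor (b.vec j) := fun X => by
      have := c.hor_vertical _ (b.sub_mem X)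
      rw [map_sub, sub_eq_zero] at this
      rw [this, map_sum]
      simp
    rw [map_smul, map_sum]
    simp_rw [evalTensor_lTensor_wedge, ht]
    rw [Finset.sum_comm]
    have key : ∀ i : Fin (p + 1), ∑ j, (-1) ^ (i : ℕ) * (HForm.toLin V (b.form j) (X i) *
        Form.insert (p := q + p) (c.hor (b.vec j)) w
          (Fin.append (fun i => (Y i : D)) (fun l => c.hor (i.removeNth X l)))) =
        (-1) ^ q * w (Fin.append (fun i => (Y i : D)) (fun j => c.hor (X j))) := fun i => by
      rw [← Finset.mul_sum]
      have e := Form.cons_sum (p := q + p) w Finset.univ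
        (fun j => HForm.toLin V (b.form j) (X i)) (fun j => c.hor (b.vec j))
        (Fin.append (fun i => (Y i : D)) (fun l => c.hor (i.removeNth X l)))
      rw [← hsum] at e
      refine (congrArg _ e.symm).trans ?_
      have e' := Form.cons_removeNth (p := q + p) w (Fin.natAdd q i)
        (Fin.append (m := q) (n := p + 1) (fun i => (Y i : D)) (fun j => c.hor (X j)))
      rw [removeNth_natAdd_append, Fin.append_right] at e'
      rw [← e', ← mul_assoc, Fin.val_natAdd, pow_add, ← mul_assoc ((-1 : A) ^ q),
        neg_one_pow_mul_self, one_mul]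
      rfl
    refine (congrArg _ (Finset.sum_congr rfl (fun i _ => key i))).trans ?_
    rw [Finset.sum_const, Finset.card_univ, Fintype.card_fin, nsmul_eq_mul, smul_eq_mul]
    calc _ = (u * ((p + 1 : ℕ) : A)) * ((-1) ^ q * (-1) ^ q) *
          w (Fin.append (fun i => (Y i : D)) (fun j => c.hor (X j))) := by ring
      _ = _ := by rw [hu, neg_one_pow_mul_self, one_mul, one_mul]

/-- In each summand either η receives one of the vertical arguments and vanishes, or all of them are
left for w, which then has too many. -/
theorem wedgeForm_mem {q p : ℕ} (η : HForm V 1) {w : Form A D (q + p)}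
    (hw : w ∈ filtration V p (q + p)) :
    wedgeForm (HForm.toLin V η) w ∈ filtration V (p + 1) (q + p + 1) := by
  classical
  intro s hs X hX
  rw [wedgeForm_apply]
  refine Finset.sum_eq_zero (fun i _ => ?_)
  by_cases hi : i ∈ s
  · have h0 : HForm.toLin V η (X i) = 0 :=
      HForm.apply_eq_zero η (fun _ => X i) 0 (hX i hi)
    rw [h0, zero_mul, mul_zero]
  · have hs' : s.card ≤ (Finset.univ.filter (fun l => i.succAbove l ∈ s)).card := by
      refine Finset.card_le_card_of_surjOn i.succAbove (fun j hj => ?_)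
      obtain ⟨l, rfl⟩ := Fin.exists_succAbove_eq (x := j) (y := i) (by rintro rfl; exact hi hj)
      exact ⟨l, by rw [Finset.mem_coe, Finset.mem_filter]; exact ⟨Finset.mem_univ l, hj⟩, rfl⟩
    have h0 : w (i.removeNth X) = 0 :=
      hw (Finset.univ.filter (fun l => i.succAbove l ∈ s)) (by omega) _
        (fun l hl => hX _ (by simpa using hl))
    rw [h0, mul_zero, mul_zero]

/-- Every element of `VΛ^q ⊗ Λ̄^p` comes from a form in `Λ_p^{q+p}`. -/
theorem HorizontalSystem.exists_form (b : HorizontalSystem V ι)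
    (hA : ∀ p : ℕ, IsUnit ((p + 1 : ℕ) : A)) {q p : ℕ} (t : VForm V q ⊗[A] HForm V p) :
    ∃ w ∈ filtration V p (q + p), ∀ Y X,
      evalTensor Y X t = w (Fin.append (fun i => (Y i : D)) X) := by
  induction p with
  | zero =>
    obtain ⟨σ, rfl⟩ := exists_tmul_one t
    obtain ⟨w, rfl⟩ := Submodule.Quotient.mk_surjective _ σ
    refine ⟨w, mem_filtration_zero w, fun Y X => ?_⟩
    rw [evalTensor_tmul, HForm.one_apply, mul_one, Subsingleton.elim X Fin.elim0, Fin.append_elim0]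
    rfl
  | succ p ih =>
    obtain ⟨u, hu⟩ := (hA p).exists_left_inv
    choose w hw hw' using fun j => ih ((HForm.insert p (b.vec j)).lTensor (VForm V q) t)
    -- Again Euler's identity, with w j a form representing the contraction of t with e_j. Summands
    -- in which η_j receives a vertical field vanish, so only the last p + 1 places count, at the
    -- price of the sign (-1)^q.
    refine ⟨(u * (-1) ^ q) • ∑ j, wedgeForm (HForm.toLin V (b.form j)) (w j),
      Submodule.smul_mem _ _ (Submodule.sum_mem _ (fun j _ => wedgeForm_mem _ (hw j))),
      fun Y X => ?_⟩
    have e : t = u • ∑ j, (wedge V p (b.form j)).lTensor (VForm V q)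
        ((HForm.insert p (b.vec j)).lTensor (VForm V q) t) := by
      rw [b.sum_lTensor, smul_smul, hu, one_smul]
    have key : ∀ j, wedgeForm (HForm.toLin V (b.form j)) (w j)
        (Fin.append (m := q) (n := p + 1) (fun i => (Y i : D)) X) =
        (-1) ^ q * evalTensor Y X ((wedge V p (b.form j)).lTensor (VForm V q)
        ((HForm.insert p (b.vec j)).lTensor (VForm V q) t)) := fun j => by
      rw [evalTensor_lTensor_wedge]
      refine (wedgeForm_apply (r := q + p) _ _ _).trans ?_
      refine (Fin.sum_univ_add (a := q) (b := p + 1) _).trans ?_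
      rw [Finset.sum_eq_zero, zero_add, Finset.mul_sum]
      · refine Finset.sum_congr rfl (fun i _ => ?_)
        rw [hw' j, Fin.append_right]
        rw [Fin.val_natAdd, pow_add, mul_assoc, ← removeNth_natAdd_append]
      · intro i _
        have h0 : HForm.toLin V (b.form j) (Y i) = 0 :=
          HForm.apply_eq_zero (b.form j) (fun _ => (Y i : D)) 0 (Y i).2
        rw [Fin.append_left, h0, zero_mul, mul_zero]
    refine Eq.trans ?_ (Form.smul_apply _ _ _).symm
    refine Eq.trans ?_ (congrArg _ (Form.sum_apply _ _ _).symm)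
    simp_rw [key]
    rw [← Finset.mul_sum, ← map_sum]
    conv_lhs => rw [e]
    rw [map_smul, smul_eq_mul, ← mul_assoc, mul_assoc u, neg_one_pow_mul_self, mul_one]

end Algebra

end AffineForms

/-! ### Local frames, the affine space of connections, and linear parts -/

namespace AffineForms

section Algebra

variable {A : Type*} [CommRing A] {D : Type*} [AddCommGroup D] [Module A D] {V : Submodule A D}

variable (V) in
/-- A local frame of rank `n` for the module of vector fields modulo the vertical ones, which is a
frame where the function `scale` is invertible. -/
structure LocalFrame (n : ℕ) where
  /-- the scaling function -/
  scale : A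
  /-- the horizontal forms -/
  form : Fin n → HForm V 1
  /-- the vector fields -/
  vec : Fin n → D
  sub_mem : ∀ X : D, scale • X - ∑ i, HForm.toLin V (form i) X • vec i ∈ V
  form_vec : ∀ i j, HForm.toLin V (form i) (vec j) = if i = j then scale else 0

/-- Split each scaled argument into a vertical remainder and a combination of frame fields, and
expand. A summand with at least k - n remainders dies by the filtration; any other has more than n
frame fields, so one is repeated and alternation kills it. -/
theorem LocalFrame.pow_mul_apply_eq_zero {n k : ℕ} (φ : LocalFrame V n) {w : Form A D k}
    (hw : w ∈ filtration V (n + 1) k) (X : Fin k → D) : φ.scale ^ k * w X = 0 := by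
  classical
  have h1 : φ.scale ^ k * w X = w (fun l => φ.scale • X l) := by
    have := MultilinearMap.map_smul_univ (AlternatingMap.toMultilinearMap w)
      (fun _ => φ.scale) X
    simp only [Finset.prod_const, Finset.card_univ, Fintype.card_fin] at this
    exact this.symm
  -- The value `none` selects the vertical remainder, with coefficient 1; `some i` selects the i-th
  -- frame field.
  let c : Fin k → Option (Fin n) → A := fun l o => o.elim 1 (fun i => HForm.toLin V (φ.form i) (X l))
  let Z : Fin k → Option (Fin n) → D := fun l o => o.elim
    (φ.scale • X l - ∑ i, HForm.toLin V (φ.form i) (X l) • φ.vec i) φ.vec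
  have h2 : (fun l => φ.scale • X l) = fun l => ∑ o, c l o • Z l o := by
    funext l
    simp [Fintype.sum_option, c, Z]
  rw [h1, h2]
  refine (MultilinearMap.map_sum (AlternatingMap.toMultilinearMap w) _).trans ?_
  refine Finset.sum_eq_zero (fun ρ _ => ?_)
  refine (MultilinearMap.map_smul_univ (AlternatingMap.toMultilinearMap w)
    (fun l => c l (ρ l)) (fun l => Z l (ρ l))).trans ?_
  suffices h : w (fun l => Z l (ρ l)) = 0 by
    exact (congrArg _ h).trans (smul_zero _)
  by_cases hs : k < n + 1 + (Finset.univ.filter (fun l => ρ l = none)).card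
  · refine hw _ hs _ (fun l hl => ?_)
    have hl' : ρ l = none := by simpa using hl
    change Z l (ρ l) ∈ V
    rw [hl']
    exact φ.sub_mem (X l)
  · have hcard := Finset.card_filter_add_card_filter_not (s := (Finset.univ : Finset (Fin k)))
      (fun l => ρ l = none)
    rw [Finset.card_univ, Fintype.card_fin] at hcard
    have hlt : ((Finset.univ : Finset (Fin n)).map Function.Embedding.some).card <
        (Finset.univ.filter (fun l => ¬ ρ l = none)).card := by
      rw [Finset.card_map, Finset.card_univ, Fintype.card_fin]
      omega
    obtain ⟨l, hl, l', -, hne, heq⟩ := Finset.exists_ne_map_eq_of_card_lt_of_maps_to hlt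
      (f := ρ) (fun l hl => by
        obtain ⟨i, hi⟩ := Option.ne_none_iff_exists'.1 (Finset.mem_filter.1 hl).2
        simp [hi])
    obtain ⟨i, hi⟩ := Option.ne_none_iff_exists'.1 (Finset.mem_filter.1 hl).2
    refine AlternatingMap.map_eq_zero_of_eq w _ (i := l) (j := l') ?_ hne
    simp only [← heq, hi, Z, Option.elim_some]

/-- An r-tuple chosen from r + 1 frame fields misses some index i. Evaluating the wedge of the i-th
form with ρ on the i-th field followed by the tuple leaves only scale times ρ of the tuple.
Expanding the r scaled arguments then costs r further powers of the scale. -/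
theorem LocalFrame.pow_mul_apply_eq_zero_of_wedge {r : ℕ} (φ : LocalFrame V (r + 1))
    {ρ : HForm V r} (h : ∀ η, wedge V r η ρ = 0) (X : Fin r → D) :
    φ.scale ^ (r + 1) * ρ.1 X = 0 := by
  classical
  have key : ∀ I : Fin r → Fin (r + 1), φ.scale * ρ.1 (fun l => φ.vec (I l)) = 0 := fun I => by
    obtain ⟨i, hi⟩ : ∃ i, i ∉ Set.range I := by
      by_contra hI
      push Not at hI
      have := Fintype.card_le_of_surjective I hI
      simp at this
    have h0 : (wedge V r (φ.form i) ρ).1 (Fin.cons (φ.vec i) (fun l => φ.vec (I l))) = 0 := by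
      rw [h]; rfl
    rw [wedge_apply, Fin.sum_univ_succ, Finset.sum_eq_zero] at h0
    · rw [Fin.removeNth_zero, Fin.tail_cons, Fin.cons_zero, φ.form_vec, if_pos rfl] at h0
      simpa using h0
    · intro l _
      rw [Fin.cons_succ, φ.form_vec, if_neg (fun hl => hi ⟨l, hl.symm⟩)]
      simp
  have h1 : φ.scale ^ r * ρ.1 X = ρ.1 (fun l => φ.scale • X l) := by
    have := MultilinearMap.map_smul_univ (AlternatingMap.toMultilinearMap ρ.1)
      (fun _ => φ.scale) X
    simp only [Finset.prod_const, Finset.card_univ, Fintype.card_fin] at this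
    exact this.symm
  rw [pow_succ', mul_assoc, h1, HForm.apply_congr ρ _ _ (fun l => φ.sub_mem (X l))]
  have h2 := MultilinearMap.map_sum (AlternatingMap.toMultilinearMap ρ.1)
    (fun l i => HForm.toLin V (φ.form i) (X l) • φ.vec i)
  refine (congrArg _ h2).trans ?_
  rw [Finset.mul_sum]
  refine Finset.sum_eq_zero (fun I _ => ?_)
  have h3 := MultilinearMap.map_smul_univ (AlternatingMap.toMultilinearMap ρ.1)
    (fun l => HForm.toLin V (φ.form (I l)) (X l)) (fun l => φ.vec (I l))
  refine (congrArg _ h3).trans ?_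
  rw [smul_eq_mul, mul_left_comm]
  exact (congrArg _ (key I)).trans (mul_zero _)

/-- A linear relation that is total, and single-valued at zero, is the graph of a linear map. The
maps of the theorem are specified by formulas for their values, so they arise in this way. -/
theorem exists_linearMap_of_rel {W S : Type*} [AddCommGroup W] [Module A W] [AddCommGroup S]
    [Module A S] (R : W → S → Prop) (hadd : ∀ {w w' s s'}, R w s → R w' s' → R (w + w') (s + s'))
    (hsmul : ∀ (a : A) {w s}, R w s → R (a • w) (a • s)) (hex : ∀ w, ∃ s, R w s)
    (huniq : ∀ s, R 0 s → s = 0) : ∃ f : W →ₗ[A] S, ∀ w s, f w = s ↔ R w s := by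
  choose f hf using hex
  have hu : ∀ {w s}, R w s → f w = s := fun {w s} h => by
    have h' := hadd (hf w) (hsmul (-1) h)
    rw [neg_one_smul, neg_one_smul, add_neg_cancel] at h'
    exact sub_eq_zero.1 ((sub_eq_add_neg _ _).trans (huniq _ h'))
  exact ⟨⟨⟨f, fun w w' => hu (hadd (hf w) (hf w'))⟩, fun a w => hu (hsmul a (hf w))⟩,
    fun w s => ⟨fun h => h ▸ hf w, hu⟩⟩

theorem exists_linearEquiv_of_rel {W S : Type*} [AddCommGroup W] [Module A W] [AddCommGroup S]
    [Module A S] (R : W → S → Prop) (hadd : ∀ {w w' s s'}, R w s → R w' s' → R (w + w') (s + s'))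
    (hsmul : ∀ (a : A) {w s}, R w s → R (a • w) (a • s)) (hex : ∀ w, ∃ s, R w s)
    (huniq : ∀ s, R 0 s → s = 0) (hex' : ∀ s, ∃ w, R w s) (huniq' : ∀ w, R w 0 → w = 0) :
    ∃ f : W ≃ₗ[A] S, ∀ w s, f w = s ↔ R w s := by
  obtain ⟨f, hf⟩ := exists_linearMap_of_rel R hadd hsmul hex huniq
  refine ⟨LinearEquiv.ofBijective f ⟨?_, fun s => ?_⟩, hf⟩
  · rw [injective_iff_map_eq_zero]
    exact fun w hw => huniq' w ((hf _ _).1 hw)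
  · obtain ⟨w, hw⟩ := hex' s
    exact ⟨w, (hf _ _).2 hw⟩

theorem evalTensor_embed {r k : ℕ} (η : HForm V 1) (Y₀ : V) (Y : Fin k → V) (X : Fin (r + 1) → D)
    (s : VForm V (k + 1) ⊗[A] HForm V r) :
    evalTensor Y X (embed V r k s (η ⊗ₜ Y₀)) = (-1) ^ k * ∑ i : Fin (r + 1),
      (-1) ^ (i : ℕ) * (HForm.toLin V η (X i) *
        evalTensor (Fin.cons Y₀ Y : Fin (k + 1) → V) (i.removeNth X) s) := by
  induction s with
  | zero => simp
  | tmul σ ρ =>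
    obtain ⟨w, rfl⟩ := Submodule.Quotient.mk_surjective _ σ
    have e : embed V r k ((Submodule.Quotient.mk w : VForm V (k + 1)) ⊗ₜ ρ) (η ⊗ₜ Y₀) =
        (-1 : A) ^ k • (insertVert V k Y₀ (Submodule.Quotient.mk w) ⊗ₜ wedge V r η ρ) := rfl
    have e' : VForm.eval Y (insertVert V k Y₀ (Submodule.Quotient.mk w)) =
        VForm.eval (Fin.cons Y₀ Y : Fin (k + 1) → V) (Submodule.Quotient.mk w) := by
      change w (Fin.cons (Y₀ : D) (fun i => (Y i : D))) =
        w (fun i => ((Fin.cons Y₀ Y : Fin (k + 1) → V) i : D))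
      congr 1
      funext i
      refine Fin.cases ?_ (fun i => ?_) i <;> simp
    rw [e, map_smul, smul_eq_mul, evalTensor_tmul, e', wedge_apply, Finset.mul_sum]
    congr 1
    refine Finset.sum_congr rfl (fun i _ => ?_)
    rw [evalTensor_tmul]
    ring
  | add s₁ s₂ h₁ h₂ =>
    simp only [map_add, LinearMap.add_apply, h₁, h₂, mul_add, Finset.sum_add_distrib]

/-- Evaluation of the first factor of an element of `VΛ^q ⊗ Λ̄^p` on vertical vector fields. -/
def evalLeft {q p : ℕ} (Y : Fin q → V) : VForm V q ⊗[A] HForm V p →ₗ[A] HForm V p :=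
  TensorProduct.lift ((LinearMap.lsmul A (HForm V p)) ∘ₗ VForm.eval Y)

theorem evalLeft_apply {q p : ℕ} (Y : Fin q → V) (X : Fin p → D) (t : VForm V q ⊗[A] HForm V p) :
    (evalLeft Y t).1 X = evalTensor Y X t := by
  induction t with
  | zero => rw [map_zero, map_zero]; rfl
  | tmul σ ρ => rfl
  | add t₁ t₂ h₁ h₂ => rw [map_add, map_add, ← h₁, ← h₂]; rfl

/-- The connection of a horizontal system. -/
def HorizontalSystem.connection {ι : Type*} [Fintype ι] (b : HorizontalSystem V ι) :
    Connection V where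
  hor := ∑ j, (HForm.toLin V (b.form j)).smulRight (b.vec j)
  hor_vertical Y hY := by
    rw [LinearMap.sum_apply]
    refine Finset.sum_eq_zero (fun j _ => ?_)
    have h0 : HForm.toLin V (b.form j) Y = 0 :=
      HForm.apply_eq_zero (b.form j) (fun _ => Y) 0 hY
    rw [LinearMap.smulRight_apply, h0, zero_smul]
  sub_hor_mem X := by
    simpa [LinearMap.sum_apply] using b.sub_mem X

theorem Connection.ext {c c' : Connection V} (h : ∀ X, c.hor X = c'.hor X) : c = c' := by
  cases c; cases c'
  congr
  exact LinearMap.ext h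

theorem Connection.translate_add (c : Connection V) (Z Z' : HForm V 1 ⊗[A] V) :
    c.translate (Z + Z') = (c.translate Z).translate Z' :=
  Connection.ext (fun X => by simp [Connection.translate, add_assoc])

/-- The difference of two horizontal projectors is vertical valued and kills V, so it is determined
by its values on the e_j; finiteness of the dual system turns it into a tensor. -/
theorem HorizontalSystem.exists_translate {ι : Type*} [Fintype ι] (b : HorizontalSystem V ι)
    (c c' : Connection V) : ∃ Z, c' = c.translate Z := by
  have hsum : ∀ (c : Connection V) (X : D),
      c.hor X = ∑ j, HForm.toLin V (b.form j) X • c.hor (b.vec j) := fun c X => by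
    have := c.hor_vertical _ (b.sub_mem X)
    rw [map_sub, sub_eq_zero] at this
    rw [this, map_sum]
    simp
  refine ⟨∑ j, b.form j ⊗ₜ ⟨c'.hor (b.vec j) - c.hor (b.vec j), ?_⟩, Connection.ext fun X => ?_⟩
  · have := V.sub_mem (c.sub_hor_mem (b.vec j)) (c'.sub_hor_mem (b.vec j))
    rwa [sub_sub_sub_cancel_left] at this
  · change c'.hor X = c.hor X + toEnd V _ X
    rw [map_sum, LinearMap.sum_apply, ← sub_eq_iff_eq_add', hsum c X, hsum c' X,
      ← Finset.sum_sub_distrib]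
    refine Finset.sum_congr rfl (fun j _ => ?_)
    rw [← smul_sub]
    rfl

theorem append_update_right {α : Type*} {q p : ℕ} (Y : Fin q → α) (X : Fin p → α) (i : Fin p)
    (x : α) : Fin.append Y (Function.update X i x) =
      Function.update (Fin.append Y X) (Fin.natAdd q i) x := by
  funext l
  refine Fin.addCases (fun l => ?_) (fun l => ?_) l
  · rw [Fin.append_left, Function.update_of_ne, Fin.append_left]
    simp [Fin.ext_iff]; omega
  · rw [Fin.append_right]
    rcases eq_or_ne l i with rfl | h
    · simp
    · rw [Function.update_of_ne h, Function.update_of_ne, Fin.append_right]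
      simpa [Fin.ext_iff] using h

/-- The components of a form in `Λ_r^{k+1+r}` with respect to varying connections form an affine
form, whose linear part corresponds to the same form. -/
theorem HorizontalSystem.hasLinearPart {ι : Type*} [Fintype ι] (b : HorizontalSystem V ι)
    (hA : ∀ p : ℕ, IsUnit ((p + 1 : ℕ) : A)) {r k : ℕ} {w : Form A D (k + 1 + r)}
    (hw : w ∈ filtration V r (k + 1 + r))
    {φ : Connection V → VForm V k ⊗[A] HForm V (r + 1)}
    (hφ : ∀ (c : Connection V) (Y : Fin k → V) (X : Fin (r + 1) → D), evalTensor Y X (φ c) =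
      w (Fin.append (fun i => (Y i : D)) (fun j => c.hor (X j)) ∘
        Fin.cast (Nat.add_right_comm k 1 r)))
    {s : VForm V (k + 1) ⊗[A] HForm V r}
    (hs : ∀ (Y : Fin (k + 1) → V) (X : Fin r → D),
      evalTensor Y X s = w (Fin.append (fun i => (Y i : D)) X)) :
    HasLinearPart φ (embed V r k s) := by
  classical
  intro c Z
  -- Generalizing over the connection lets a sum of tensors be applied one summand at a time, so
  -- pure tensors suffice.
  induction Z generalizing c with
  | zero =>
    rw [map_zero, add_zero]
    congr 1
    exact Connection.ext (fun X => by simp [Connection.translate])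
  | add Z₁ Z₂ h₁ h₂ => rw [Connection.translate_add, h₂, h₁, map_add, add_assoc]
  | tmul η Y₀ =>
    refine b.ext_evalTensor hA (fun Y X => ?_)
    let w' : Form A D (k + (r + 1)) := w.cast (Nat.add_right_comm k 1 r)
    have hw' : w' ∈ filtration V r (k + (r + 1)) :=
      (Form.cast_mem (Nat.add_right_comm k 1 r)).2 hw
    have hφ' : ∀ c, evalTensor Y X (φ c) =
        w'.appendRight (fun i => (Y i : D)) (fun j => c.hor (X j)) := fun c => by
      rw [hφ, Form.appendRight_apply]
      exact (Form.cast_apply (Nat.add_right_comm k 1 r) w _).symm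
    have e : (fun j => (c.translate (η ⊗ₜ Y₀)).hor (X j)) =
        (fun j => c.hor (X j)) + fun j => HForm.toLin V η (X j) • (Y₀ : D) := rfl
    -- Expansion around the old connection: constant term, linear term, and terms with at least two
    -- places filled by multiples of Y₀.
    rw [map_add, hφ', hφ', e, MultilinearMap.map_add_eq_map_add_linearDeriv_add, add_assoc]
    congr 1
    rw [Finset.sum_eq_zero, add_zero, MultilinearMap.linearDeriv_apply, evalTensor_embed,
      Finset.mul_sum]
    · refine Finset.sum_congr rfl (fun i _ => ?_)
      rw [MultilinearMap.map_update_smul, Form.appendRight_apply, append_update_right]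
      -- Moving Y₀ from place k + i to the front gives (-1)^(k+i): the factor (-1)^k is the sign in
      -- `embed`, and (-1)^i the sign of the wedge product.
      have h1 := Form.apply_update (p := k + r) w' (Fin.natAdd k i) (Y₀ : D)
        (Fin.append (m := k) (n := r + 1) (fun i => (Y i : D)) (fun j => c.hor (X j)))
      rw [removeNth_natAdd_append] at h1
      refine (congrArg _ h1).trans ?_
      have h2 : w' (Fin.cons (Y₀ : D) (Fin.append (fun i => (Y i : D))
          (i.removeNth (fun j => c.hor (X j))))) =
          evalTensor (Fin.cons Y₀ Y : Fin (k + 1) → V) (i.removeNth X) s := by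
        refine (Form.cast_apply (Nat.add_right_comm k 1 r) w _).trans ?_
        rw [hs, ← Fin.append_cons]
        have e3 : (Fin.cons (Y₀ : D) (fun i => (Y i : D)) : Fin (k + 1) → D) =
            fun i => ((Fin.cons Y₀ Y : Fin (k + 1) → V) i : D) := by
          funext i
          refine Fin.cases ?_ (fun i => ?_) i <;> simp
        rw [e3]
        -- With Y₀ in front there are k + 1 vertical arguments, so the horizontal projections in the
        -- remaining r places may be dropped.
        refine filtration.append_congr hw _ _ _ (fun l => ?_)
        have := V.neg_mem (c.sub_hor_mem (i.removeNth X l))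
        rwa [neg_sub] at this
      rw [h2, smul_eq_mul, Fin.val_natAdd, pow_add]
      ring
    -- Two multiples of Y₀ together with the k fields Y make at least k + 2 vertical arguments, too
    -- many for Λ_r^{k+1+r}.
    · intro t ht
      rw [Form.appendRight_apply]
      refine filtration.append_eq_zero hw' Y _ t (fun i hi => ?_) ?_
      · rw [Finset.piecewise_eq_of_mem _ _ _ hi]
        exact V.smul_mem _ Y₀.2
      · have := (Finset.mem_filter.1 ht).2
        omega

end Algebra

end AffineForms

/-! ### The isomorphisms and the two exact rows, in algebraic form -/

namespace AffineForms

section Algebra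

variable {A : Type*} [CommRing A] {D : Type*} [AddCommGroup D] [Module A D] {V : Submodule A D}
  {r : ℕ}

/-! ### The correspondences are linear relations -/

theorem LinCorresponds.add : {q : ℕ} → {w w' : Form A D (q + r)} → {s s' : LinForm V r q} →
    LinCorresponds V r q w s → LinCorresponds V r q w' s' →
      LinCorresponds V r q (w + w') (s + s')
  | 0, _, _, _, _, h, h' => fun X => congrArg₂ (· + ·) (h X) (h' X)
  | _ + 1, _, _, _, _, h, h' => fun Y X =>
    (map_add (evalTensor Y X) _ _).trans (congrArg₂ (· + ·) (h Y X) (h' Y X))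

theorem LinCorresponds.smul (a : A) : {q : ℕ} → {w : Form A D (q + r)} → {s : LinForm V r q} →
    LinCorresponds V r q w s → LinCorresponds V r q (a • w) (a • s)
  | 0, _, _, h => fun X => congrArg (a * ·) (h X)
  | _ + 1, _, _, h => fun Y X =>
    (map_smul (evalTensor Y X) a _).trans (congrArg (a * ·) (h Y X))

theorem AffCorresponds.add : {q : ℕ} → {w w' : Form A D (q + r)} → {θ θ' : AffForm V r q} →
    AffCorresponds V r q w θ → AffCorresponds V r q w' θ' →
      AffCorresponds V r q (w + w') (θ + θ')
  | 0, _, _, _, _, h, h' => fun X => congrArg₂ (· + ·) (h X) (h' X)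
  | _ + 1, _, _, _, _, h, h' => fun c Y X =>
    (map_add (evalTensor Y X) _ _).trans (congrArg₂ (· + ·) (h c Y X) (h' c Y X))

theorem AffCorresponds.smul (a : A) : {q : ℕ} → {w : Form A D (q + r)} → {θ : AffForm V r q} →
    AffCorresponds V r q w θ → AffCorresponds V r q (a • w) (a • θ)
  | 0, _, _, h => fun X => congrArg (a * ·) (h X)
  | _ + 1, _, _, h => fun c Y X =>
    (map_smul (evalTensor Y X) a _).trans (congrArg (a * ·) (h c Y X))

theorem ZeroCorresponds.add : {q : ℕ} → {w w' : Form A D (q + r)} → {θ θ' : AffForm V r q} →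
    ZeroCorresponds V r q w θ → ZeroCorresponds V r q w' θ' →
      ZeroCorresponds V r q (w + w') (θ + θ')
  | 0, _, _, _, _, h, h' => (congrArg₂ (· + ·) h h').trans (add_zero _)
  | _ + 1, _, _, _, _, h, h' => fun c Y X =>
    (map_add (evalTensor Y X) _ _).trans (congrArg₂ (· + ·) (h c Y X) (h' c Y X))

theorem ZeroCorresponds.smul (a : A) : {q : ℕ} → {w : Form A D (q + r)} → {θ : AffForm V r q} →
    ZeroCorresponds V r q w θ → ZeroCorresponds V r q (a • w) (a • θ)
  | 0, _, _, h => (congrArg (a • ·) h).trans (smul_zero _)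
  | _ + 1, _, _, h => fun c Y X =>
    (map_smul (evalTensor Y X) a _).trans (congrArg (a * ·) (h c Y X))

/-! ### Existence and uniqueness of corresponding elements -/

/-- With the converse `LinCorresponds.of_mem_succ`, this identifies the kernel of w ↦ s with
Λ_{r+1}^{q+r}, which is what allows passing to the quotient `E0`. -/
theorem LinCorresponds.mem_succ : {q : ℕ} → {w : Form A D (q + r)} →
    LinCorresponds V r q w 0 → w ∈ filtration V (r + 1) (q + r)
  | 0, _, h => filtration.mem_succ (fun Y X => by
      rw [Subsingleton.elim (fun i => (Y i : D)) Fin.elim0]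
      exact (h X).symm)
  | _ + 1, _, h => filtration.mem_succ (fun Y X =>
      (h Y X).symm.trans (map_zero (evalTensor Y X)))

theorem LinCorresponds.of_mem_succ : {q : ℕ} → {w : Form A D (q + r)} →
    w ∈ filtration V (r + 1) (q + r) → LinCorresponds V r q w 0
  | 0, _, h => fun X => by
      rw [filtration.eq_zero_of_lt (by omega) h]; rfl
  | _ + 1, _, h => fun Y X => by
      rw [filtration.append_eq_zero h Y X ∅ (by simp) (by simp)]
      exact map_zero (evalTensor Y X)

namespace HorizontalSystem

variable {ι : Type*} [Fintype ι] (b : HorizontalSystem V ι)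
  (hA : ∀ p : ℕ, IsUnit ((p + 1 : ℕ) : A))

include b hA in
theorem exists_linCorresponds : {q : ℕ} → {w : Form A D (q + r)} →
    w ∈ filtration V r (q + r) → ∃ s, LinCorresponds V r q w s
  | 0, w, h => ⟨(⟨w.cast (Nat.zero_add r), (Form.cast_mem _).2 h⟩ : HForm V r), fun X => by
      rw [Fin.elim0_append]
      exact Form.cast_apply _ _ _⟩
  | k + 1, w, h => by
      -- Any connection would do: next to k + 1 vertical arguments, projecting the other r changes
      -- nothing.
      obtain ⟨s, hs⟩ := b.exists_component hA b.connection w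
      refine ⟨s, fun Y X => (hs Y X).trans (filtration.append_congr h Y _ _ (fun l => ?_))⟩
      have := V.neg_mem (b.connection.sub_hor_mem (X l))
      rwa [neg_sub] at this

include b hA in
theorem exists_form_linCorresponds : {q : ℕ} → (s : LinForm V r q) →
    ∃ w ∈ filtration V r (q + r), LinCorresponds V r q w s
  | 0, (s : HForm V r) => ⟨s.1.cast (Nat.zero_add r).symm, (Form.cast_mem _).2 s.2, fun X => by
      rw [Fin.elim0_append, Form.cast_apply]
      rfl⟩
  | _ + 1, s => b.exists_form hA s

include b hA in
theorem eq_zero_of_linCorresponds : {q : ℕ} → {s : LinForm V r q} →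
    LinCorresponds V r q 0 s → s = 0
  | 0, _, h => Subtype.ext (Form.ext h)
  | _ + 1, _, h => b.eq_zero_of_evalTensor hA h

include b hA in
theorem isLinPart : {q : ℕ} → {w : Form A D (q + r)} → w ∈ filtration V r (q + r) →
    {θ : AffForm V r q} → {s : LinForm V r q} → AffCorresponds V r q w θ →
    LinCorresponds V r q w s → IsLinPart V r q θ s
  | 0, _, _, _, _, hθ, hs => Subtype.ext (Form.ext fun X => (hθ X).trans (hs X).symm)
  | _ + 1, _, hw, _, _, hθ, hs => b.hasLinearPart hA hw hθ hs

include b hA in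
theorem exists_affCorresponds : {q : ℕ} → {w : Form A D (q + r)} →
    w ∈ filtration V r (q + r) → ∃ θ, AffCorresponds V r q w θ
  | 0, _, h => b.exists_linCorresponds hA h
  | k + 1, w, h => by
      -- The degree (k + 1) + r is regrouped as k + (r + 1): one vertical place becomes a horizontal
      -- one.
      choose φ hφ using fun c =>
        b.exists_component hA (p := r + 1) c (w.cast (Nat.add_right_comm k 1 r))
      obtain ⟨s, hs⟩ := b.exists_linCorresponds hA h
      have hφ' : ∀ (c : Connection V) (Y : Fin k → V) (X : Fin (r + 1) → D),
          evalTensor Y X (φ c) = w (Fin.append (fun i => (Y i : D)) (fun j => c.hor (X j)) ∘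
            Fin.cast (Nat.add_right_comm k 1 r)) := fun c Y X =>
        (hφ c Y X).trans (Form.cast_apply (Nat.add_right_comm k 1 r) w _)
      exact ⟨(⟨φ, s, b.hasLinearPart hA h hφ' hs⟩ : affineFormSucc V r k), hφ'⟩

include b hA in
theorem eq_zero_of_affCorresponds : {q : ℕ} → {θ : AffForm V r q} →
    AffCorresponds V r q 0 θ → θ = 0
  | 0, _, h => Subtype.ext (Form.ext h)
  | _ + 1, _, h => Subtype.ext (funext fun c => b.eq_zero_of_evalTensor hA (h c))

include b hA in
theorem eq_zero_of_zeroCorresponds : {q : ℕ} → {θ : AffForm V r q} →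
    ZeroCorresponds V r q 0 θ → θ = 0
  | 0, _, h => h
  | _ + 1, _, h => Subtype.ext (funext fun c => b.eq_zero_of_evalTensor hA (h c))

/-- The components of a form in `Λ_{r+1}^{q+r}` do not depend on the connection. -/
theorem _root_.AffineForms.AffCorresponds.of_zeroCorresponds : {q : ℕ} → {w : Form A D (q + r)} →
    w ∈ filtration V (r + 1) (q + r) → {θ : AffForm V r q} → ZeroCorresponds V r q w θ →
      AffCorresponds V r q w θ
  | 0, w, hw, θ, h => fun X => by
      rw [filtration.eq_zero_of_lt (by omega) hw, h]; rfl
  | k + 1, w, hw, θ, h => fun c Y X => by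
      have hw' := (Form.cast_mem (Nat.add_right_comm k 1 r)).2 hw
      have := filtration.append_congr (p := r + 1) hw' Y X (fun j => c.hor (X j))
        (fun j => c.sub_hor_mem (X j))
      refine (h c Y X).trans ?_
      have e := Form.cast_apply (Nat.add_right_comm k 1 r) w
      exact ((e _).symm.trans this).trans (e _)

include b hA in
theorem exists_zeroCorresponds : {q : ℕ} → {w : Form A D (q + r)} →
    w ∈ filtration V (r + 1) (q + r) → ∃ θ ∈ affForm0 V r q, ZeroCorresponds V r q w θ
  | 0, _, _ => ⟨0, Submodule.zero_mem _, rfl⟩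
  | k + 1, w, hw => by
      have hw' := (Form.cast_mem (Nat.add_right_comm k 1 r)).2 hw
      obtain ⟨t, ht⟩ := b.exists_component hA (p := r + 1) b.connection
        (w.cast (Nat.add_right_comm k 1 r))
      have ht' : ∀ (Y : Fin k → V) (X : Fin (r + 1) → D), evalTensor Y X t =
          w (Fin.append (fun i => (Y i : D)) X ∘ Fin.cast (Nat.add_right_comm k 1 r)) :=
        fun Y X => ((ht Y X).trans (filtration.append_congr (p := r + 1) hw' Y X _
          (fun j => b.connection.sub_hor_mem (X j))).symm).trans
            (Form.cast_apply (Nat.add_right_comm k 1 r) w _)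
      have h0 : HasLinearPart (fun _ : Connection V => t) (embed V r k 0) := fun c Z => by simp
      exact ⟨(⟨fun _ => t, 0, h0⟩ : affineFormSucc V r k), h0, fun c Y X => ht' Y X⟩

include b hA in
theorem exists_form_zeroCorresponds : {q : ℕ} → {θ : AffForm V r q} → θ ∈ affForm0 V r q →
    ∃ w ∈ filtration V (r + 1) (q + r), ZeroCorresponds V r q w θ
  | 0, _, hθ => ⟨0, Submodule.zero_mem _, hθ⟩
  | k + 1, θ, hθ => by
      obtain ⟨w, hw, h⟩ := b.exists_form hA (θ.1 b.connection)
      refine ⟨Form.cast (Nat.add_right_comm k 1 r).symm w, (Form.cast_mem _).2 hw,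
        fun c Y X => ?_⟩
      -- All connections are translates of one, so θ is constant and a form representing its value
      -- at `b.connection` represents it everywhere.
      obtain ⟨Z, rfl⟩ := b.exists_translate b.connection c
      have e : θ.1 (b.connection.translate Z) = θ.1 b.connection := by
        refine (hθ b.connection Z).trans ?_
        change _ + embed V r k 0 Z = _
        rw [map_zero, LinearMap.zero_apply, add_zero]
      rw [e, h]
      exact (Form.cast_apply (Nat.add_right_comm k 1 r).symm w
        (Fin.append (fun i => (Y i : D)) X ∘ Fin.cast (Nat.add_right_comm k 1 r))).symm

theorem _root_.AffineForms.IsLinPart.exists : {q : ℕ} → (θ : AffForm V r q) →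
    ∃ s, IsLinPart V r q θ s
  | 0, θ => ⟨θ, rfl⟩
  | _ + 1, θ => θ.2

include b hA in
-- Uniqueness of the linear part. For vertical Y_1, …, Y_{k+1}, the value of the linear map at η ⊗
-- Y_1 on the remaining Y's is, up to sign, the wedge of η with the horizontal r-form s(Y_1, …,
-- Y_{k+1}). As η is arbitrary, `hwedge` makes that r-form zero.
theorem eq_zero_of_isLinPart
    (hwedge : ∀ ρ : HForm V r, (∀ η, wedge V r η ρ = 0) → ρ = 0) : {q : ℕ} →
    {s : LinForm V r q} → IsLinPart V r q 0 s → s = 0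
  | 0, _, h => h.symm
  | k + 1, (s : VForm V (k + 1) ⊗[A] HForm V r), h => by
      refine b.eq_zero_of_evalTensor hA (fun Y X => ?_)
      rw [← evalLeft_apply, hwedge (evalLeft Y s)]
      · rfl
      · intro η
        apply Subtype.ext
        ext X
        have h1 : embed V r k s (η ⊗ₜ Y 0) = 0 := by
          have := h b.connection (η ⊗ₜ Y 0)
          change (0 : VForm V k ⊗[A] HForm V (r + 1)) = 0 + _ at this
          rw [zero_add] at this
          exact this.symm
        have h2 := evalTensor_embed η (Y 0) (Fin.tail Y) X s
        rw [h1, map_zero, Fin.cons_self_tail] at h2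
        have h3 := congrArg (fun x => (-1) ^ k * x) h2
        rw [← mul_assoc, neg_one_pow_mul_self, one_mul, mul_zero] at h3
        rw [wedge_apply]
        simp_rw [evalLeft_apply]
        exact h3.symm

/-- Reduces injectivity to the vanishing of Λ_{r+2}. A connection is required because for q > 0 the
hypothesis speaks only of values at connections. -/
theorem _root_.AffineForms.ZeroCorresponds.mem_filtration : {q : ℕ} → {w : Form A D (q + r)} →
    w ∈ filtration V (r + 1) (q + r) → Connection V → ZeroCorresponds V r q w 0 →
      w ∈ filtration V (r + 2) (q + r)
  | 0, _, hw, _, _ => by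
      rw [filtration.eq_zero_of_lt (by omega) hw]
      exact Submodule.zero_mem _
  | k + 1, w, _, c, h => by
      refine (Form.cast_mem (Nat.add_right_comm k 1 r)).1 (filtration.mem_succ (p := r + 1)
        (fun Y X => ?_))
      refine (Form.cast_apply (Nat.add_right_comm k 1 r) w _).trans ((h c Y X).symm.trans ?_)
      exact map_zero (evalTensor Y X)

theorem _root_.AffineForms.ZeroCorresponds.of_affCorresponds : {q : ℕ} → {w : Form A D (q + r)} →
    w ∈ filtration V (r + 1) (q + r) → {θ : AffForm V r q} → AffCorresponds V r q w θ →
      ZeroCorresponds V r q w θ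
  | 0, w, hw, θ, h => by
      rw [filtration.eq_zero_of_lt (by omega) hw] at h
      exact Subtype.ext (Form.ext h)
  | k + 1, w, hw, θ, h => fun c Y X => by
      have hw' := (Form.cast_mem (Nat.add_right_comm k 1 r)).2 hw
      have := filtration.append_congr (p := r + 1) hw' Y X (fun j => c.hor (X j))
        (fun j => c.sub_hor_mem (X j))
      refine (h c Y X).trans ?_
      have e := Form.cast_apply (Nat.add_right_comm k 1 r) w
      exact ((e _).symm.trans this.symm).trans (e _)

include b hA in
/-- The algebraic form of the description of affine forms. -/
theorem exists_affineForm_isomorphisms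
    (hwedge : ∀ ρ : HForm V r, (∀ η, wedge V r η ρ = 0) → ρ = 0)
    (hrank : ∀ {k : ℕ} {w : Form A D k}, w ∈ filtration V (r + 2) k → w = 0) :
    ∃ lin : ∀ q : ℕ, AffForm V r q →ₗ[A] LinForm V r q,
      (∀ q θ s, lin q θ = s ↔ IsLinPart V r q θ s) ∧
    ∃ ι₀ : ∀ q : ℕ, filtration V (r + 1) (q + r) ≃ₗ[A] affForm0 V r q,
    ∃ ι : ∀ q : ℕ, filtration V r (q + r) ≃ₗ[A] AffForm V r q,
    ∃ ιbar : ∀ q : ℕ, E0 V r q ≃ₗ[A] LinForm V r q,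
      (∀ q w θ, ι₀ q w = θ ↔ ZeroCorresponds V r q w.1 θ.1) ∧
      (∀ q w θ, ι q w = θ ↔ AffCorresponds V r q w.1 θ) ∧
      (∀ q (w : filtration V r (q + r)) s,
        ιbar q (Submodule.Quotient.mk w) = s ↔ LinCorresponds V r q w.1 s) ∧
      (∀ q w, ι q (Submodule.inclusion (filtration_succ_le V r (q + r)) w) =
        (ι₀ q w : AffForm V r q)) ∧
      (∀ q (w : filtration V r (q + r)),
        lin q (ι q w) = ιbar q (Submodule.Quotient.mk w)) ∧
      (∀ q : ℕ,
        Function.Injective (Submodule.inclusion (filtration_succ_le V r (q + r))) ∧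
        Function.Exact (Submodule.inclusion (filtration_succ_le V r (q + r)))
          ((filtration V (r + 1) (q + r)).submoduleOf (filtration V r (q + r))).mkQ ∧
        Function.Surjective
          ((filtration V (r + 1) (q + r)).submoduleOf (filtration V r (q + r))).mkQ) ∧
      (∀ q : ℕ,
        Function.Injective (affForm0 V r q).subtype ∧
        Function.Exact (affForm0 V r q).subtype (lin q) ∧
        Function.Surjective (lin q)) := by
  choose lin hlin using fun q => exists_linearMap_of_rel (A := A) (IsLinPart V r q)
    (fun h h' => IsLinPart.add V r q h h') (fun a _ _ h => IsLinPart.smul V r q a h)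
    IsLinPart.exists (fun s h => b.eq_zero_of_isLinPart hA hwedge h)
  choose ι₀ hι₀ using fun q => exists_linearEquiv_of_rel (A := A)
    (fun (w : filtration V (r + 1) (q + r)) (θ : affForm0 V r q) => ZeroCorresponds V r q w.1 θ.1)
    (fun h h' => ZeroCorresponds.add h h') (fun a _ _ h => ZeroCorresponds.smul a h)
    (fun w => by
      obtain ⟨θ, hθ, h⟩ := b.exists_zeroCorresponds hA w.2
      exact ⟨⟨θ, hθ⟩, h⟩)
    (fun θ h => Subtype.ext (b.eq_zero_of_zeroCorresponds hA h))
    (fun θ => by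
      obtain ⟨w, hw, h⟩ := b.exists_form_zeroCorresponds hA θ.2
      exact ⟨⟨w, hw⟩, h⟩)
    (fun w h => Subtype.ext (hrank (ZeroCorresponds.mem_filtration w.2 b.connection h)))
  -- The symbol map on Λ_r^{q+r}. It is onto with kernel Λ_{r+1}^{q+r}, so it induces the
  -- isomorphism from `E0`.
  choose L hL using fun q => exists_linearMap_of_rel (A := A)
    (fun (w : filtration V r (q + r)) (s : LinForm V r q) => LinCorresponds V r q w.1 s)
    (fun h h' => LinCorresponds.add h h') (fun a _ _ h => LinCorresponds.smul a h)
    (fun w => b.exists_linCorresponds hA w.2) (fun s h => b.eq_zero_of_linCorresponds hA h)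
  have hLsurj : ∀ q, Function.Surjective (L q) := fun q s => by
    obtain ⟨w, hw, h⟩ := b.exists_form_linCorresponds hA s
    exact ⟨⟨w, hw⟩, (hL _ _ _).2 h⟩
  have hLker : ∀ q, (filtration V (r + 1) (q + r)).submoduleOf (filtration V r (q + r)) =
      LinearMap.ker (L q) := fun q => by
    ext w
    rw [LinearMap.mem_ker, hL, Submodule.submoduleOf, Submodule.mem_comap]
    exact ⟨LinCorresponds.of_mem_succ, LinCorresponds.mem_succ⟩
  let ιbar : ∀ q : ℕ, E0 V r q ≃ₗ[A] LinForm V r q := fun q =>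
    (Submodule.quotEquivOfEq _ _ (hLker q)).trans ((L q).quotKerEquivOfSurjective (hLsurj q))
  have hιbar : ∀ q (w : filtration V r (q + r)), ιbar q (Submodule.Quotient.mk w) = L q w :=
    fun q w => rfl
  choose ι hι using fun q => exists_linearEquiv_of_rel (A := A)
    (fun (w : filtration V r (q + r)) (θ : AffForm V r q) => AffCorresponds V r q w.1 θ)
    (fun h h' => AffCorresponds.add h h') (fun a _ _ h => AffCorresponds.smul a h)
    (fun w => b.exists_affCorresponds hA w.2) (fun θ h => b.eq_zero_of_affCorresponds hA h)
    -- Surjectivity: lift the linear part of θ to a form w₁ and subtract its affine form. The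
    -- difference has zero linear part, hence comes from some w₂ in Λ_{r+1}^{q+r}, and w₁ + w₂
    -- represents θ.
    (fun θ => by
      obtain ⟨s, hs⟩ := IsLinPart.exists θ
      obtain ⟨w₁, hw₁, h₁⟩ := b.exists_form_linCorresponds hA s
      obtain ⟨θ₁, hθ₁⟩ := b.exists_affCorresponds hA hw₁
      have h0 : θ - θ₁ ∈ affForm0 V r q := by
        have := IsLinPart.add V r q hs (IsLinPart.smul V r q (-1) (b.isLinPart hA hw₁ hθ₁ h₁))
        rwa [neg_one_smul, neg_one_smul, add_neg_cancel, ← sub_eq_add_neg] at this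
      obtain ⟨w₂, hw₂, h₂⟩ := b.exists_form_zeroCorresponds hA h0
      refine ⟨⟨w₁ + w₂, Submodule.add_mem _ hw₁ (filtration_succ_le _ _ _ hw₂)⟩, ?_⟩
      have := hθ₁.add (AffCorresponds.of_zeroCorresponds hw₂ h₂)
      rwa [add_sub_cancel] at this)
    -- Injectivity: if the affine form is zero, so is its linear part; thus w lies in Λ_{r+1}^{q+r},
    -- then in Λ_{r+2}^{q+r}, which is zero.
    (fun w h => by
      obtain ⟨s, hs⟩ := b.exists_linCorresponds hA w.2
      have hs0 := b.eq_zero_of_isLinPart hA hwedge (b.isLinPart hA w.2 h hs)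
      rw [hs0] at hs
      have hw := hs.mem_succ
      exact Subtype.ext (hrank (ZeroCorresponds.mem_filtration hw b.connection
        (ZeroCorresponds.of_affCorresponds hw h))))
  have hsq : ∀ q (w : filtration V r (q + r)), lin q (ι q w) = L q w := fun q w =>
    (hlin _ _ _).2 (b.isLinPart hA w.2 ((hι _ _ _).1 rfl) ((hL _ _ _).1 rfl))
  refine ⟨lin, hlin, ι₀, ι, ιbar, hι₀, hι, fun q w s => hL q w s, fun q w => ?_, hsq, fun q => ?_,
    fun q => ⟨Subtype.val_injective, fun θ => ?_, fun s => ?_⟩⟩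
  · exact (hι _ _ _).2 (AffCorresponds.of_zeroCorresponds w.2 ((hι₀ _ _ _).1 rfl))
  · refine ⟨Submodule.inclusion_injective _, fun w => ?_, Submodule.mkQ_surjective _⟩
    rw [Submodule.mkQ_apply, Submodule.Quotient.mk_eq_zero]
    exact ⟨fun h => ⟨⟨w.1, h⟩, rfl⟩, by rintro ⟨v, rfl⟩; exact v.2⟩
  · rw [hlin]
    exact ⟨fun h => ⟨⟨θ, h⟩, rfl⟩, by rintro ⟨v, rfl⟩; exact v.2⟩
  · obtain ⟨w, rfl⟩ := hLsurj q s
    exact ⟨ι q w, hsq q w⟩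

end HorizontalSystem

end Algebra

end AffineForms

/-! ### Derivations at a point are determined by differentials -/

namespace AffineForms

section Geometry

open MeasureTheory Set Filter Topology
open scoped Convolution

/-! ### Local coordinates and derivations at a point -/

/-- **Hadamard's lemma.** -/
theorem exists_contDiff_sub_eq_apply {E : Type*} [NormedAddCommGroup E] [NormedSpace ℝ E]
    {G : E → ℝ} (hG : ContDiff ℝ ∞ G) (c : E) :
    ∃ L : E → E →L[ℝ] ℝ, ContDiff ℝ ∞ L ∧ L c = fderiv ℝ G c ∧ ∀ z, G z - G c = L z (z - c) := by
  have hG' : ContDiff ℝ ∞ (fderiv ℝ G) := hG.fderiv_right le_rfl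
  have hcont : ∀ z, Continuous (fun t : ℝ => fderiv ℝ G (c + t • (z - c))) := fun z =>
    hG'.continuous.comp (by fun_prop)
  refine ⟨fun z => ∫ t in (0 : ℝ)..1, fderiv ℝ G (c + t • (z - c)), ?_, by simp, fun z => ?_⟩
  -- Smooth dependence of the integral on z: it is the value at 0 of the convolution of the
  -- indicator of (0, 1] with a compactly supported kernel depending smoothly on z. The cutoff χ
  -- equals 1 on [-1, 1], so it does not alter the integral.
  · let χ : ContDiffBump (0 : ℝ) := ⟨1, 2, one_pos, one_lt_two⟩
    let f : ℝ → ℝ := indicator (Ioc 0 1) (fun _ => 1)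
    let g : E → ℝ → E →L[ℝ] ℝ := fun z t => χ t • fderiv ℝ G (c + (-t) • (z - c))
    have h := contDiffOn_convolution_right_with_param (μ := volume) (f := f) (g := g)
      (n := (⊤ : ℕ∞)) (ContinuousLinearMap.lsmul ℝ ℝ : ℝ →L[ℝ] (E →L[ℝ] ℝ) →L[ℝ] (E →L[ℝ] ℝ))
      (s := univ) (k := tsupport χ) isOpen_univ χ.hasCompactSupport
      (fun z t _ ht => by
        change χ t • _ = _
        rw [image_eq_zero_of_notMem_tsupport ht, zero_smul])
      (((integrable_indicator_iff measurableSet_Ioc).2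
        (integrableOn_const (by simp))).locallyIntegrable)
      (by
        refine ContDiff.contDiffOn ?_
        refine (χ.contDiff.comp contDiff_snd).smul (hG'.comp ?_)
        fun_prop)
    rw [univ_prod_univ, contDiffOn_univ] at h
    convert! h.comp (contDiff_prodMk_left (0 : ℝ)) using 1
    funext z
    rw [intervalIntegral.integral_of_le zero_le_one, ← integral_indicator measurableSet_Ioc]
    change _ = (f ⋆[ContinuousLinearMap.lsmul ℝ ℝ, volume] g z) 0
    rw [convolution_def]
    congr 1
    funext t
    by_cases ht : t ∈ Ioc (0 : ℝ) 1
    · have h1 : χ (0 - t) = 1 := by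
        refine χ.one_of_mem_closedBall ?_
        simp only [zero_sub, mem_closedBall_zero_iff, norm_neg, Real.norm_eq_abs]
        rw [abs_of_pos ht.1]
        exact ht.2
      simp only [f, g, indicator_of_mem ht, h1]
      simp
    · simp only [f, indicator_of_notMem ht]
      simp
  · rw [ContinuousLinearMap.intervalIntegral_apply ((hcont z).intervalIntegrable _ _)]
    have h := intervalIntegral.integral_eq_sub_of_hasDerivAt (a := 0) (b := 1)
      (f := fun t : ℝ => G (c + t • (z - c)))
      (f' := fun t : ℝ => fderiv ℝ G (c + t • (z - c)) (z - c)) (fun t _ => by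
        have h1 : HasDerivAt (fun t : ℝ => c + t • (z - c)) (z - c) t := by
          simpa using ((hasDerivAt_id t).smul_const (z - c)).const_add c
        exact ((hG.differentiable (by simp)).differentiableAt).hasFDerivAt.comp_hasDerivAt t h1)
      (((hcont z).clm_apply continuous_const).intervalIntegrable _ _)
    rw [h]
    simp

variable {E : Type*} [NormedAddCommGroup E] [NormedSpace ℝ E] [FiniteDimensional ℝ E]
  {M : Type*} [TopologicalSpace M] [T2Space M] [ChartedSpace E M] [IsManifold 𝓘(ℝ, E) ∞ M]

/-- Around every point there are local coordinates that extend to the whole manifold, and in which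
smooth functions are the restrictions of smooth functions on the whole model space. -/
theorem exists_local_coordinates (x : M) : ∃ (ψ : C^∞⟮𝓘(ℝ, E), M; 𝓘(ℝ, E), E⟯) (U : Set M),
    IsOpen U ∧ x ∈ U ∧ (∀ y ∈ U, Function.Bijective (mfderiv 𝓘(ℝ, E) 𝓘(ℝ, E) ψ y)) ∧
    ∀ (W : Type) [NormedAddCommGroup W] [NormedSpace ℝ W] (f : M → W),
      ContMDiff 𝓘(ℝ, E) 𝓘(ℝ, W) ∞ f →
        ∃ F : E → W, ContDiff ℝ ∞ F ∧ ∀ y ∈ U, f y = F (ψ y) := by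
  let χ : SmoothBumpFunction 𝓘(ℝ, E) x := Classical.arbitrary _
  let φ := extChartAt 𝓘(ℝ, E) x
  obtain ⟨ε, hε, hball⟩ := Metric.nhds_basis_closedBall.mem_iff.1
    (extChartAt_target_mem_nhds (I := 𝓘(ℝ, E)) x)
  let β : ContDiffBump (φ x) := ⟨ε / 2, ε, half_pos hε, half_lt_self hε⟩
  have h1 : ∀ᶠ y in 𝓝 x, χ y = 1 := χ.eventuallyEq_one
  have h2 : ∀ᶠ y in 𝓝 x, y ∈ φ.source := extChartAt_source_mem_nhds x
  have h3 : ∀ᶠ y in 𝓝 x, β (φ y) = 1 := (continuousAt_extChartAt x).eventually β.eventuallyEq_one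
  have hψ : ContMDiff 𝓘(ℝ, E) 𝓘(ℝ, E) ∞ (fun y => χ y • φ y) :=
    χ.contMDiff_smul (contMDiffOn_extChartAt (I := 𝓘(ℝ, E)) (n := ∞) (x := x))
  -- The chart is cut off on the manifold by χ, and functions read in the chart are cut off by β on
  -- the model space; U is where neither cutoff is visible.
  refine ⟨⟨fun y => χ y • φ y, hψ⟩, interior {y | χ y = 1 ∧ y ∈ φ.source ∧ β (φ y) = 1},
    isOpen_interior, mem_interior_iff_mem_nhds.2 (h1.and (h2.and h3)), fun y hy => ?_,
    fun W _ _ f hf => ⟨fun z => β z • f (φ.symm z), ?_, fun y hy => ?_⟩⟩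
  · have e : (fun y => χ y • φ y) =ᶠ[𝓝 y] φ := by
      filter_upwards [mem_interior_iff_mem_nhds.1 hy] with z hz
      rw [hz.1, one_smul]
    change Function.Bijective (mfderiv 𝓘(ℝ, E) 𝓘(ℝ, E) (fun y => χ y • φ y) y)
    rw [e.mfderiv_eq]
    have : IsManifold 𝓘(ℝ, E) 1 M := IsManifold.of_le (n := ∞) (by simp)
    obtain ⟨A, hA⟩ := isInvertible_mfderiv_extChartAt (I := 𝓘(ℝ, E)) (interior_subset hy).2.1
    rw [← hA]
    exact A.bijective
  · rw [contDiff_iff_contDiffAt]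
    intro z
    by_cases hz : z ∈ φ.target
    · have h := (hf.comp_contMDiffOn (contMDiffOn_extChartAt_symm (I := 𝓘(ℝ, E)) (n := ∞) x))
      have h' := h.contDiffOn.contDiffAt ((isOpen_extChartAt_target x).mem_nhds hz)
      exact β.contDiff.contDiffAt.smul h'
    · have hz' : z ∉ tsupport β := fun h => hz (hball (by rwa [β.tsupport_eq] at h))
      have e : (fun z => β z • f (φ.symm z)) =ᶠ[𝓝 z] fun _ => 0 := by
        filter_upwards [(isClosed_tsupport β).isOpen_compl.mem_nhds hz'] with y hy
        rw [image_eq_zero_of_notMem_tsupport hy, zero_smul]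
      exact contDiffAt_const.congr_of_eventuallyEq e
  · obtain ⟨hy1, hy2, hy3⟩ := interior_subset hy
    change f y = β (χ y • φ y) • f (φ.symm (χ y • φ y))
    rw [hy1, one_smul, hy3, one_smul, φ.left_inv hy2]

omit [FiniteDimensional ℝ E] [T2Space M] [IsManifold 𝓘(ℝ, E) ∞ M] in
theorem mdifferentiableAt_smoothMap {W : Type*} [NormedAddCommGroup W] [NormedSpace ℝ W]
    (f : C^∞⟮𝓘(ℝ, E), M; 𝓘(ℝ, W), W⟯) (x : M) : MDifferentiableAt 𝓘(ℝ, E) 𝓘(ℝ, W) f x :=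
  f.contMDiff.mdifferentiableAt (by simp)

/-- A derivation at a point only depends on the germ of a function. -/
theorem derivation_eq_zero_of_eventuallyEq {x : M} {δ : C^∞⟮𝓘(ℝ, E), M; ℝ⟯ →ₗ[ℝ] ℝ}
    (hδ : ∀ f g, δ (f * g) = f x * δ g + g x * δ f) {g : C^∞⟮𝓘(ℝ, E), M; ℝ⟯}
    (hg : ∀ᶠ y in 𝓝 x, g y = 0) : δ g = 0 := by
  obtain ⟨χ, hχ⟩ := (SmoothBumpFunction.nhds_basis_support (I := 𝓘(ℝ, E)) hg).mem_iff.1 hg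
  let χ' : C^∞⟮𝓘(ℝ, E), M; ℝ⟯ := ⟨χ, χ.contMDiff⟩
  have h0 : χ' * g = 0 := by
    ext y
    by_cases hy : y ∈ Function.support χ
    · have : g y = 0 := hχ.2 hy
      simp [this]
    · have : χ' y = 0 := Function.notMem_support.1 hy
      simp [this]
  have h1 := hδ χ' g
  have h2 : χ' x = 1 := χ.eq_one
  rw [h0, map_zero, h2, hg.self_of_nhds] at h1
  simpa using h1.symm

/-- A derivation at a point vanishes on functions with zero differential there. -/
theorem derivation_eq_zero_of_mfderiv_eq_zero {x : M} {δ : C^∞⟮𝓘(ℝ, E), M; ℝ⟯ →ₗ[ℝ] ℝ}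
    (hδ : ∀ f g, δ (f * g) = f x * δ g + g x * δ f) {g : C^∞⟮𝓘(ℝ, E), M; ℝ⟯}
    (hg : mfderiv 𝓘(ℝ, E) 𝓘(ℝ, ℝ) g x = 0) : δ g = 0 := by
  obtain ⟨ψ, U, hU, hxU, hψ, hF⟩ := exists_local_coordinates (E := E) x
  obtain ⟨F, hF, hFg⟩ := hF ℝ g g.contMDiff
  have hgF : g =ᶠ[𝓝 x] F ∘ ψ := by
    filter_upwards [hU.mem_nhds hxU] with y hy using hFg y hy
  have hdF : fderiv ℝ F (ψ x) = 0 := by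
    have hFd : DifferentiableAt ℝ F (ψ x) := (hF.differentiable (by simp)).differentiableAt
    rw [hgF.mfderiv_eq, mfderiv_comp x hFd.mdifferentiableAt (mdifferentiableAt_smoothMap ψ x),
      mfderiv_eq_fderiv] at hg
    ext v
    obtain ⟨u, rfl⟩ := (hψ x hxU).2 v
    exact congrArg (fun L => L u) hg
  -- Near x, g - g(x) becomes a sum of products l i * k i. Both factors vanish at x, the l i because
  -- the differential does, so the Leibniz rule kills every product.
  obtain ⟨L, hL, hLc, hLz⟩ := exists_contDiff_sub_eq_apply hF (ψ x)
  let b := Module.finBasis ℝ E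
  let l : Fin (Module.finrank ℝ E) → C^∞⟮𝓘(ℝ, E), M; ℝ⟯ := fun i =>
    ⟨fun y => L (ψ y) (b i), ((hL.clm_apply contDiff_const).contMDiff).comp ψ.contMDiff⟩
  let k : Fin (Module.finrank ℝ E) → C^∞⟮𝓘(ℝ, E), M; ℝ⟯ := fun i =>
    ⟨fun y => (b.coord i).toContinuousLinearMap (ψ y - ψ x),
      (((b.coord i).toContinuousLinearMap.contDiff.comp
        (contDiff_id.sub contDiff_const)).contMDiff).comp ψ.contMDiff⟩
  have hconst : ∀ a : ℝ, δ (algebraMap ℝ C^∞⟮𝓘(ℝ, E), M; ℝ⟯ a) = 0 := fun a => by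
    have h1 := hδ 1 1
    have h2 : (1 : C^∞⟮𝓘(ℝ, E), M; ℝ⟯) x = 1 := rfl
    rw [one_mul, h2, one_mul] at h1
    rw [Algebra.algebraMap_eq_smul_one, map_smul]
    have h3 : δ 1 = 0 := by linarith
    rw [h3, smul_zero]
  have h0 : ∀ᶠ y in 𝓝 x, (g - algebraMap ℝ C^∞⟮𝓘(ℝ, E), M; ℝ⟯ (g x) - ∑ i, l i * k i) y = 0 := by
    filter_upwards [hU.mem_nhds hxU] with y hy
    have e : (∑ i, l i * k i) y = L (ψ y) (ψ y - ψ x) := by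
      have e1 : (∑ i, l i * k i) y = ∑ i, l i y * k i y :=
        map_sum (ContMDiffMap.evalRingHom (I := 𝓘(ℝ, E)) (I' := 𝓘(ℝ, ℝ)) (n := ∞) y :
          C^∞⟮𝓘(ℝ, E), M; ℝ⟯ →+* ℝ) _ _
      rw [e1]
      conv_rhs => rw [← b.sum_repr (ψ y - ψ x), map_sum]
      refine Finset.sum_congr rfl (fun i _ => ?_)
      rw [map_smul, smul_eq_mul, mul_comm]
      rfl
    change g y - g x - (∑ i, l i * k i) y = 0
    rw [e, hFg y hy, hFg x hxU, hLz, sub_self]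
  have h1 := derivation_eq_zero_of_eventuallyEq hδ h0
  rw [map_sub, map_sub, hconst, sub_zero, map_sum, Finset.sum_eq_zero, sub_zero] at h1
  · exact h1
  · intro i _
    have hl : l i x = 0 := by
      change L (ψ x) (b i) = 0
      rw [hLc, hdF]; rfl
    have hk : k i x = 0 := by
      change (b.coord i).toContinuousLinearMap (ψ x - ψ x) = 0
      rw [sub_self, map_zero]
    rw [hδ, hl, hk, zero_mul, zero_mul, add_zero]

end Geometry

end AffineForms

/-! ### Finitely many functions with jointly injective differentials, by generic projection -/

namespace AffineForms

section Immersion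

open Set Filter Topology Module

variable {E : Type*} [NormedAddCommGroup E] [NormedSpace ℝ E]
  {M : Type*} [TopologicalSpace M] [ChartedSpace E M]

/-! ### Immersions into finite dimensional spaces -/

theorem mfderiv_clm_comp_apply {W W' : Type*} [NormedAddCommGroup W] [NormedSpace ℝ W]
    [NormedAddCommGroup W'] [NormedSpace ℝ W'] (ℓ : W →L[ℝ] W') {f : M → W} {y : M}
    (hf : MDifferentiableAt 𝓘(ℝ, E) 𝓘(ℝ, W) f y) (v : TangentSpace 𝓘(ℝ, E) y) :
    (mfderiv 𝓘(ℝ, E) 𝓘(ℝ, W') (fun z => ℓ (f z)) y v : W') =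
      ℓ (mfderiv 𝓘(ℝ, E) 𝓘(ℝ, W) f y v : W) := by
  have h := mfderiv_comp (I'' := 𝓘(ℝ, W')) y (ℓ.differentiableAt.mdifferentiableAt) hf
  rw [mfderiv_eq_fderiv, ℓ.fderiv] at h
  exact congrArg (fun L => L v) h

variable [FiniteDimensional ℝ E] [T2Space M] [IsManifold 𝓘(ℝ, E) ∞ M]

/-- Collect the coordinate maps of a finite subcover. The n zero coordinates are padding: they put
the dimension in the form n + d, ready for an induction on d. -/
theorem exists_immersion_on_isCompact {K : Set M} (hK : IsCompact K) (n : ℕ) :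
    ∃ (d : ℕ) (f : M → (Fin (n + d) → ℝ)), ContMDiff 𝓘(ℝ, E) 𝓘(ℝ, Fin (n + d) → ℝ) ∞ f ∧
      ∀ y ∈ K, ∀ v : TangentSpace 𝓘(ℝ, E) y,
        (mfderiv 𝓘(ℝ, E) 𝓘(ℝ, Fin (n + d) → ℝ) f y v : Fin (n + d) → ℝ) = 0 → v = 0 := by
  choose ψ U hU hxU hψ _ using exists_local_coordinates (E := E) (M := M)
  obtain ⟨t, -, ht⟩ := hK.elim_nhds_subcover U (fun x _ => (hU x).mem_nhds (hxU x))
  let e : ((Fin n → ℝ) × (t → E)) ≃L[ℝ] (Fin (n + finrank ℝ (t → E)) → ℝ) :=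
    ContinuousLinearEquiv.ofFinrankEq (by simp)
  have hf : ContMDiff 𝓘(ℝ, E) 𝓘(ℝ, Fin (n + finrank ℝ (t → E)) → ℝ) ∞
      (fun y => e (0, fun x : t => ψ x y)) := by
    have h1 : ContMDiff 𝓘(ℝ, E) 𝓘(ℝ, t → E) ∞ (fun y => fun x : t => ψ x y) :=
      contMDiff_pi_space.2 (fun x => (ψ x).contMDiff)
    have h2 : ContDiff ℝ ∞ (fun z : t → E => e (0, z)) :=
      e.contDiff.comp (contDiff_const.prodMk contDiff_id)
    exact h2.contMDiff.comp h1
  refine ⟨_, fun y => e (0, fun x : t => ψ x y), hf, fun y hy v hv => ?_⟩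
  obtain ⟨x, hx, hyx⟩ := mem_iUnion₂.1 (ht hy)
  let ℓ : (Fin (n + finrank ℝ (t → E)) → ℝ) →L[ℝ] E :=
    ((ContinuousLinearMap.proj (R := ℝ) (φ := fun _ : t => E) ⟨x, hx⟩).comp
      (ContinuousLinearMap.snd ℝ (Fin n → ℝ) (t → E))).comp e.symm.toContinuousLinearMap
  have h1 := mfderiv_clm_comp_apply ℓ (hf.mdifferentiableAt (by simp) (x := y)) v
  replace h1 := h1.trans ((congrArg ℓ hv).trans (map_zero ℓ))
  have h2 : (fun y => ℓ (e (0, fun x : t => ψ x y))) = ψ x := by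
    funext z
    simp [ℓ]
  rw [h2] at h1
  refine (hψ x y hyx).1 ?_
  rw [map_zero]
  exact h1

/-- The differentials of a smooth map into a space of dimension greater than `2 dim M` do not
cover that space. -/
theorem exists_notMem_range_mfderiv [SecondCountableTopology M] {L : ℕ} {f : M → (Fin L → ℝ)}
    (hf : ContMDiff 𝓘(ℝ, E) 𝓘(ℝ, Fin L → ℝ) ∞ f) (hL : 2 * finrank ℝ E < L) :
    ∃ w : Fin L → ℝ, ∀ (y : M) (v : TangentSpace 𝓘(ℝ, E) y),
      (mfderiv 𝓘(ℝ, E) 𝓘(ℝ, Fin L → ℝ) f y v : Fin L → ℝ) ≠ w := by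
  choose ψ U hU hxU hψ hF using exists_local_coordinates (E := E) (M := M)
  choose F hF hFf using fun x => hF x (Fin L → ℝ) f hf
  obtain ⟨s, hs, hsU⟩ := TopologicalSpace.countable_cover_nhds
    (fun x => (hU x).mem_nhds (hxU x))
  -- The values of the differentials are covered by countably many C¹ images of E × E, so their
  -- Hausdorff dimension is at most 2 dim M.
  have hdim : dimH (⋃ x ∈ s, range (fun p : E × E => fderiv ℝ (F x) p.1 p.2)) <
      finrank ℝ (Fin L → ℝ) := by
    rw [dimH_bUnion hs]
    refine lt_of_le_of_lt (b := ((2 * finrank ℝ E : ℕ) : ENNReal)) (iSup₂_le fun x _ => ?_)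
      (by rw [finrank_fin_fun]; exact_mod_cast hL)
    have h1 : ContDiff ℝ 1 (fun p : E × E => fderiv ℝ (F x) p.1 p.2) :=
      ((((hF x).fderiv_right (m := ∞) le_rfl).of_le (by simp)).comp contDiff_fst).clm_apply
        contDiff_snd
    refine h1.dimH_range_le.trans ?_
    rw [finrank_prod, two_mul]
  obtain ⟨w, hw⟩ := (dense_compl_of_dimH_lt_finrank hdim).nonempty
  refine ⟨w, fun y v hv => hw ?_⟩
  obtain ⟨x, hx, hyx⟩ := mem_iUnion₂.1 (hsU.symm ▸ mem_univ y : y ∈ ⋃ x ∈ s, U x)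
  refine mem_iUnion₂.2 ⟨x, hx, (ψ x y, mfderiv 𝓘(ℝ, E) 𝓘(ℝ, E) (ψ x) y v), ?_⟩
  rw [← hv]
  have e : f =ᶠ[𝓝 y] F x ∘ ψ x := by
    filter_upwards [(hU x).mem_nhds hyx] with z hz using hFf x z hz
  have hFd : DifferentiableAt ℝ (F x) (ψ x y) :=
    ((hF x).differentiable (by simp)).differentiableAt
  have h := mfderiv_comp y hFd.mdifferentiableAt (mdifferentiableAt_smoothMap (ψ x) y)
  rw [← e.mfderiv_eq, mfderiv_eq_fderiv] at h
  exact (congrArg (fun L => L v) h).symm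

/-- Generic projection along a line. -/
theorem exists_immersion_of_succ [SecondCountableTopology M] {L : ℕ} {S : Set M}
    {f : M → (Fin (L + 1) → ℝ)}
    (hf : ContMDiff 𝓘(ℝ, E) 𝓘(ℝ, Fin (L + 1) → ℝ) ∞ f) (hL : 2 * finrank ℝ E ≤ L)
    (hS : ∀ y ∈ S, ∀ v : TangentSpace 𝓘(ℝ, E) y,
      (mfderiv 𝓘(ℝ, E) 𝓘(ℝ, Fin (L + 1) → ℝ) f y v : Fin (L + 1) → ℝ) = 0 → v = 0) :
    ∃ g : M → (Fin L → ℝ), ContMDiff 𝓘(ℝ, E) 𝓘(ℝ, Fin L → ℝ) ∞ g ∧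
      ∀ y ∈ S, ∀ v : TangentSpace 𝓘(ℝ, E) y,
        (mfderiv 𝓘(ℝ, E) 𝓘(ℝ, Fin L → ℝ) g y v : Fin L → ℝ) = 0 → v = 0 := by
  obtain ⟨w, hw⟩ := exists_notMem_range_mfderiv hf (Nat.lt_succ_of_le hL)
  -- Zero is a value of every differential, so w = 0 can only occur when M is empty. Otherwise
  -- project along the line of w: a tangent vector lost by the projection is either in the kernel
  -- already or has a multiple mapped to w.
  by_cases hw0 : w = 0
  · refine ⟨fun _ => 0, contMDiff_const, fun y hy => ?_⟩
    exact absurd ((map_zero (mfderiv 𝓘(ℝ, E) 𝓘(ℝ, Fin (L + 1) → ℝ) f y)).trans hw0.symm) (hw y 0)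
  have hrank : finrank ℝ ((Fin (L + 1) → ℝ) ⧸ (ℝ ∙ w)) = finrank ℝ (Fin L → ℝ) := by
    have h1 := Submodule.finrank_quotient_add_finrank (ℝ ∙ w)
    rw [finrank_span_singleton hw0, finrank_fin_fun] at h1
    rw [finrank_fin_fun]
    omega
  let π : (Fin (L + 1) → ℝ) →L[ℝ] (Fin L → ℝ) :=
    ((LinearEquiv.ofFinrankEq _ _ hrank).toLinearMap ∘ₗ (ℝ ∙ w).mkQ).toContinuousLinearMap
  have hπ : ∀ u, π u = 0 → u ∈ ℝ ∙ w := fun u hu => by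
    have : (LinearEquiv.ofFinrankEq _ _ hrank) ((ℝ ∙ w).mkQ u) = 0 := hu
    rwa [LinearEquiv.map_eq_zero_iff, Submodule.mkQ_apply, Submodule.Quotient.mk_eq_zero] at this
  refine ⟨fun y => π (f y), π.contDiff.contMDiff.comp hf, fun y hy v hv => ?_⟩
  rw [mfderiv_clm_comp_apply π (hf.mdifferentiableAt (by simp))] at hv
  obtain ⟨c, hc⟩ := Submodule.mem_span_singleton.1 (hπ _ hv)
  by_cases hc0 : c = 0
  · refine hS y hy v ?_
    rw [← hc, hc0, zero_smul]
    rfl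
  · refine absurd ?_ (hw y (c⁻¹ • v))
    refine (map_smul (mfderiv 𝓘(ℝ, E) 𝓘(ℝ, Fin (L + 1) → ℝ) f y) c⁻¹ v).trans ?_
    refine (congrArg (c⁻¹ • ·) hc.symm).trans ?_
    change c⁻¹ • c • w = w
    rw [smul_smul, inv_mul_cancel₀ hc0, one_smul]

/-- The number of functions no longer depends on K. This uniform bound lets infinitely many compact
pieces share finitely many functions. -/
theorem exists_immersion_on_isCompact_of_finrank [SecondCountableTopology M] {K : Set M}
    (hK : IsCompact K) :
    ∃ f : M → (Fin (2 * finrank ℝ E) → ℝ),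
      ContMDiff 𝓘(ℝ, E) 𝓘(ℝ, Fin (2 * finrank ℝ E) → ℝ) ∞ f ∧
      ∀ y ∈ K, ∀ v : TangentSpace 𝓘(ℝ, E) y, (mfderiv 𝓘(ℝ, E) 𝓘(ℝ, Fin (2 * finrank ℝ E) → ℝ) f y v
        : Fin (2 * finrank ℝ E) → ℝ) = 0 → v = 0 := by
  obtain ⟨d, hd⟩ := exists_immersion_on_isCompact (E := E) hK (2 * finrank ℝ E)
  induction d with
  | zero => exact hd
  | succ d ih =>
    obtain ⟨f, hf, h⟩ := hd
    exact ih (exists_immersion_of_succ hf (Nat.le_add_right _ _) h)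

/-- Every second countable Hausdorff manifold admits an immersion into a finite dimensional
space. -/
theorem exists_immersion [SecondCountableTopology M] :
    ∃ f : Fin 3 × Fin (2 * finrank ℝ E) → C^∞⟮𝓘(ℝ, E), M; ℝ⟯,
      ∀ (y : M) (v : TangentSpace 𝓘(ℝ, E) y),
        (∀ j, (mfderiv 𝓘(ℝ, E) 𝓘(ℝ, ℝ) (f j) y v : ℝ) = 0) → v = 0 := by
  have : LocallyCompactSpace M := Manifold.locallyCompact_of_finiteDimensional 𝓘(ℝ, E)
  -- After two shifts every point first appears at an index of the form j + 2, so the shells C j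
  -- cover M.
  let K : CompactExhaustion M := (CompactExhaustion.choice M).shiftr.shiftr
  have hK0 : ∀ x, 2 ≤ K.find x := fun x => by
    simp only [K, CompactExhaustion.find_shiftr]; omega
  let C : ℕ → Set M := fun j => K (j + 2) \ interior (K (j + 1))
  have hC : ∀ j, IsCompact (C j) := fun j => (K.isCompact _).diff isOpen_interior
  let O : ℕ → Set M := fun j => interior (K (j + 3)) \ K j
  have hO : ∀ j, IsOpen (O j) := fun j => isOpen_interior.sdiff (K.isCompact _).isClosed
  have hCO : ∀ j, C j ⊆ interior (O j) := fun j x hx => by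
    rw [(hO j).interior_eq]
    exact ⟨K.subset_interior_succ _ hx.1, fun h => hx.2 (K.subset_interior_succ _ h)⟩
  choose g hg hgK using fun j => exists_immersion_on_isCompact_of_finrank (E := E) (hC j)
  choose χ hχ1 hχ0 _ using fun j => exists_contMDiffMap_one_nhds_of_subset_interior 𝓘(ℝ, E)
    (n := (⊤ : ℕ∞)) (hC j).isClosed (hCO j)
  have hgsm : ∀ j i, ContMDiff 𝓘(ℝ, E) 𝓘(ℝ, ℝ) ∞ (fun y => g j y i) := fun j i =>
    contMDiff_pi_space.1 (hg j) i
  -- O j and O l are disjoint once the indices differ by at least 3. Within one residue class mod 3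
  -- the cut-off immersions therefore do not interfere and can be added into a single function.
  let F : Fin 3 × Fin (2 * finrank ℝ E) → M → ℝ := fun c y =>
    ∑ᶠ j : ℕ, if j % 3 = (c.1 : ℕ) then χ j y * g j y c.2 else 0
  have hF : ∀ c, ContMDiff 𝓘(ℝ, E) 𝓘(ℝ, ℝ) ∞ (F c) := fun c => by
    refine contMDiff_finsum (fun j => ?_) (fun y => ?_)
    · by_cases h : j % 3 = (c.1 : ℕ)
      · simp only [h, if_true]
        exact (χ j).contMDiff.mul (hgsm j c.2)
      · simp only [h, if_false]
        exact contMDiff_const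
    · obtain ⟨m, hm⟩ := K.exists_mem_nhds y
      refine ⟨K m, hm, (finite_lt_nat m).subset ?_⟩
      rintro j ⟨z, hz, hzm⟩
      by_contra hj
      refine hz ?_
      have : χ j z = 0 := hχ0 j z (fun h => h.2 (K.subset (not_lt.1 hj) hzm))
      simp [this]
  refine ⟨fun c => ⟨F c, hF c⟩, fun y v hv => ?_⟩
  obtain ⟨j, hj⟩ : ∃ j, K.find y = j + 2 := ⟨K.find y - 2, by have := hK0 y; omega⟩
  have hyC : y ∈ C j := by
    refine ⟨hj ▸ K.mem_find y, fun h => ?_⟩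
    have := K.mem_iff_find_le.1 (interior_subset h)
    omega
  have hev : ∀ᶠ z in 𝓝 y, χ j z = 1 := (hχ1 j).filter_mono (nhds_le_nhdsSet hyC)
  have hFg : ∀ᶠ z in 𝓝 y, ∀ i, F (⟨j % 3, Nat.mod_lt _ (by norm_num)⟩, i) z = g j z i := by
    filter_upwards [hev] with z hz i
    have hzO : z ∈ O j := by
      by_contra h
      rw [hχ0 j z h] at hz
      exact zero_ne_one hz
    refine (finsum_eq_single _ j (fun l hl => ?_)).trans (by simp [hz])
    by_cases hmod : l % 3 = j % 3
    · have hzl : z ∉ O l := fun h => by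
        rcases lt_or_gt_of_ne hl with hlt | hlt
        · exact hzO.2 (K.subset (by omega) (interior_subset h.1))
        · exact h.2 (K.subset (by omega) (interior_subset hzO.1))
      simp [hχ0 l z hzl]
    · simp [hmod]
  refine hgK j y hyC v (funext fun i => ?_)
  have h1 := mfderiv_clm_comp_apply (ContinuousLinearMap.proj (R := ℝ)
    (φ := fun _ : Fin (2 * finrank ℝ E) => ℝ) i) ((hg j).mdifferentiableAt (by simp)) v
  refine h1.symm.trans ?_
  have h2 : F (⟨j % 3, Nat.mod_lt _ (by norm_num)⟩, i) =ᶠ[𝓝 y] fun z => g j z i := by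
    filter_upwards [hFg] with z hz using hz i
  refine Eq.trans ?_ (hv (⟨j % 3, Nat.mod_lt _ (by norm_num)⟩, i))
  exact congrArg (fun L : E →L[ℝ] ℝ => L v) h2.mfderiv_eq.symm

end Immersion

end AffineForms

/-! ### Constructing and testing derivations -/

namespace AffineForms

section VectorFields

open Set Filter Topology Module

variable {E : Type*} [NormedAddCommGroup E] [NormedSpace ℝ E]
  {M : Type*} [TopologicalSpace M] [ChartedSpace E M]

/-! ### Vector fields -/

variable (E) in
/-- The differential at a point, as a linear map on smooth functions. -/
noncomputable def differentialAt (y : M) : C^∞⟮𝓘(ℝ, E), M; ℝ⟯ →ₗ[ℝ] (E →L[ℝ] ℝ) where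
  toFun g := mfderiv 𝓘(ℝ, E) 𝓘(ℝ, ℝ) g y
  map_add' f g := mfderiv_add (mdifferentiableAt_smoothMap f y) (mdifferentiableAt_smoothMap g y)
  map_smul' a g := const_smul_mfderiv (mdifferentiableAt_smoothMap g y) a

theorem smoothMap_sum_apply {κ : Type*} (s : Finset κ) (f : κ → C^∞⟮𝓘(ℝ, E), M; ℝ⟯) (y : M) :
    (∑ j ∈ s, f j) y = ∑ j ∈ s, f j y :=
  map_sum (ContMDiffMap.evalRingHom (I := 𝓘(ℝ, E)) (I' := 𝓘(ℝ, ℝ)) (n := ∞) y :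
    C^∞⟮𝓘(ℝ, E), M; ℝ⟯ →+* ℝ) _ _

theorem derivation_sum_apply {R A : Type*} [CommRing R] [CommRing A] [Algebra R A] {κ : Type*}
    (s : Finset κ) (X : κ → Derivation R A A) (h : A) :
    (∑ j ∈ s, X j) h = ∑ j ∈ s, X j h :=
  map_sum (⟨⟨fun X => X h, rfl⟩, fun _ _ => rfl⟩ : Derivation R A A →+ A) _ _

/-- A locally finite linear combination of vector fields. -/
theorem exists_derivation_finsum {κ : Type*} {c : κ → C^∞⟮𝓘(ℝ, E), M; ℝ⟯}
    (hc : LocallyFinite fun i => Function.support (c i))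
    (X : κ → Derivation ℝ C^∞⟮𝓘(ℝ, E), M; ℝ⟯ C^∞⟮𝓘(ℝ, E), M; ℝ⟯) :
    ∃ Y : Derivation ℝ C^∞⟮𝓘(ℝ, E), M; ℝ⟯ C^∞⟮𝓘(ℝ, E), M; ℝ⟯,
      ∀ h q, Y h q = ∑ᶠ i, c i q * X i h q := by
  have hfin : ∀ (q : M) (u : κ → ℝ), (Function.support fun i => c i q * u i).Finite := fun q u =>
    (hc.point_finite q).subset (fun i hi => left_ne_zero_of_mul hi)
  have hsm : ∀ h, ContMDiff 𝓘(ℝ, E) 𝓘(ℝ, ℝ) ∞ (fun q => ∑ᶠ i, c i q * X i h q) := fun h =>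
    contMDiff_finsum (fun i => (c i).contMDiff.mul (X i h).contMDiff)
      (hc.subset (fun i q hq => left_ne_zero_of_mul hq))
  refine ⟨Derivation.mk' ⟨⟨fun h => ⟨_, hsm h⟩, fun f g => ?_⟩, fun a g => ?_⟩ (fun f g => ?_),
    fun h q => rfl⟩
  · ext q
    change ∑ᶠ i, c i q * X i (f + g) q = (∑ᶠ i, c i q * X i f q) + ∑ᶠ i, c i q * X i g q
    rw [← finsum_add_distrib (hfin q _) (hfin q _)]
    refine finsum_congr (fun i => ?_)
    rw [map_add, ContMDiffMap.coe_add, Pi.add_apply, mul_add]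
  · ext q
    change ∑ᶠ i, c i q * X i (a • g) q = a * ∑ᶠ i, c i q * X i g q
    rw [mul_finsum]
    refine finsum_congr (fun i => ?_)
    rw [Derivation.map_smul, ContMDiffMap.coe_smul, Pi.smul_apply, smul_eq_mul, mul_left_comm]
  · ext q
    change ∑ᶠ i, c i q * X i (f * g) q =
      f q * (∑ᶠ i, c i q * X i g q) + g q * ∑ᶠ i, c i q * X i f q
    rw [mul_finsum, mul_finsum,
      ← finsum_add_distrib]
    · refine finsum_congr (fun i => ?_)
      rw [Derivation.leibniz]
      change c i q * (f q * X i g q + g q * X i f q) = _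
      ring
    · exact (hfin q (fun i => X i g q)).subset (fun i hi => right_ne_zero_of_mul hi)
    · exact (hfin q (fun i => X i f q)).subset (fun i hi => right_ne_zero_of_mul hi)

variable [FiniteDimensional ℝ E] [T2Space M] [IsManifold 𝓘(ℝ, E) ∞ M]

/-- Every tangent vector is the value of a vector field. -/
theorem exists_derivation_eq_mfderiv (p : M) (v : E) :
    ∃ X : Derivation ℝ C^∞⟮𝓘(ℝ, E), M; ℝ⟯ C^∞⟮𝓘(ℝ, E), M; ℝ⟯,
      ∀ h, X h p = differentialAt E p h v := by
  let χ : SmoothBumpFunction 𝓘(ℝ, E) p := Classical.arbitrary _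
  let φ := extChartAt 𝓘(ℝ, E) p
  have hrep : ∀ h : C^∞⟮𝓘(ℝ, E), M; ℝ⟯, ContDiffOn ℝ ∞ (h ∘ φ.symm) φ.target := fun h =>
    (h.contMDiff.comp_contMDiffOn
      (contMDiffOn_extChartAt_symm (I := 𝓘(ℝ, E)) (n := ∞) p)).contDiffOn
  have hopen : IsOpen φ.target := isOpen_extChartAt_target p
  have hdiff : ∀ (h : C^∞⟮𝓘(ℝ, E), M; ℝ⟯) (q : M), q ∈ φ.source →
      DifferentiableAt ℝ (h ∘ φ.symm) (φ q) := fun h q hq =>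
    ((hrep h).contDiffAt (hopen.mem_nhds (φ.map_source hq))).differentiableAt (by simp)
  have hχ : ∀ q, q ∉ φ.source → χ q = 0 := fun q hq => by
    by_contra h
    refine hq ?_
    rw [extChartAt_source]
    exact χ.support_subset_source h
  -- The field is the constant vector v in a chart at p, cut off by a bump function equal to 1 at p.
  have hsm : ∀ h : C^∞⟮𝓘(ℝ, E), M; ℝ⟯,
      ContMDiff 𝓘(ℝ, E) 𝓘(ℝ, ℝ) ∞ (fun q => χ q • fderiv ℝ (h ∘ φ.symm) (φ q) v) := fun h => by
    refine χ.contMDiff_smul ?_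
    have h1 : ContDiffOn ℝ ∞ (fun z => fderiv ℝ (h ∘ φ.symm) z v) φ.target :=
      ((hrep h).fderiv_of_isOpen hopen le_rfl).clm_apply contDiffOn_const
    rw [← extChartAt_source 𝓘(ℝ, E)]
    exact h1.contMDiffOn.comp (contMDiffOn_extChartAt.mono (by rw [extChartAt_source]))
      (fun q hq => φ.map_source hq)
  refine ⟨Derivation.mk' ⟨⟨fun h => ⟨_, hsm h⟩, fun f g => ?_⟩, fun a g => ?_⟩ (fun f g => ?_),
    fun h => ?_⟩
  · ext q
    change χ q • fderiv ℝ ((f ∘ φ.symm) + (g ∘ φ.symm)) (φ q) v =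
      χ q • fderiv ℝ (f ∘ φ.symm) (φ q) v + χ q • fderiv ℝ (g ∘ φ.symm) (φ q) v
    by_cases hq : q ∈ φ.source
    · rw [fderiv_add (hdiff f q hq) (hdiff g q hq), ← smul_add]
      rfl
    · simp [hχ q hq]
  · ext q
    change χ q • fderiv ℝ (a • (g ∘ φ.symm)) (φ q) v = a • χ q • fderiv ℝ (g ∘ φ.symm) (φ q) v
    by_cases hq : q ∈ φ.source
    · rw [fderiv_const_smul (hdiff g q hq), smul_comm]
      rfl
    · simp [hχ q hq]
  · ext q
    change χ q • fderiv ℝ ((f ∘ φ.symm) * (g ∘ φ.symm)) (φ q) v =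
      f q * (χ q • fderiv ℝ (g ∘ φ.symm) (φ q) v) + g q * (χ q • fderiv ℝ (f ∘ φ.symm) (φ q) v)
    by_cases hq : q ∈ φ.source
    · rw [fderiv_mul (hdiff f q hq) (hdiff g q hq)]
      simp only [Function.comp_apply, φ.left_inv hq, add_apply,
        smul_apply, smul_eq_mul]
      ring
    · simp [hχ q hq]
  · have h1 : χ p = 1 := χ.eq_one
    have h2 := (mdifferentiableAt_smoothMap h p).mfderiv
    change χ p • fderiv ℝ (h ∘ φ.symm) (φ p) v = mfderiv 𝓘(ℝ, E) 𝓘(ℝ, ℝ) h p v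
    rw [h1, one_smul, h2]
    simp only [writtenInExtChartAt, extChartAt_model_space_eq_id, PartialEquiv.refl_coe,
      modelWithCornersSelf_coe, range_id, fderivWithin_univ, Function.id_comp]
    rfl

/-- If vector fields `Ê_i` and functions `x_i` along a smooth map `α` satisfy `Ê_i(x_l ∘ α) = u δ_il`
at a point where `u ≠ 0`, and there are `dim M` of them, then derivations at the point along `α`
are determined by their values on the `x_l`. -/
theorem derivation_eq_zero_of_frame {y : M} {κ : Type*} [Fintype κ] [DecidableEq κ]
    (hκ : Fintype.card κ = finrank ℝ E) (x : κ → C^∞⟮𝓘(ℝ, E), M; ℝ⟯)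
    (ε : κ → C^∞⟮𝓘(ℝ, E), M; ℝ⟯ →ₗ[ℝ] ℝ)
    (hε : ∀ i f g, ε i (f * g) = f y * ε i g + g y * ε i f) {u : ℝ} (hu : u ≠ 0)
    (hεx : ∀ i l, ε i (x l) = if i = l then u else 0) {δ : C^∞⟮𝓘(ℝ, E), M; ℝ⟯ →ₗ[ℝ] ℝ}
    (hδ : ∀ f g, δ (f * g) = f y * δ g + g y * δ f) (hδx : ∀ l, δ (x l) = 0) : δ = 0 := by
  -- The derivations ε i separate the differentials of the x l, which by the dimension count form a
  -- basis of the cotangent space. Any g thus agrees to first order with a combination of the x l.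
  have hli : LinearIndependent ℝ (fun l => differentialAt E y (x l)) := by
    rw [Fintype.linearIndependent_iff]
    intro c hc i
    have h1 : differentialAt E y (∑ l, c l • x l) = 0 := by
      rw [map_sum, ← hc]
      simp only [map_smul]
    have h2 := derivation_eq_zero_of_mfderiv_eq_zero (hε i) h1
    simp only [map_sum, map_smul, hεx, smul_eq_mul, mul_ite, mul_zero, Finset.sum_ite_eq,
      Finset.mem_univ, if_true] at h2
    exact (mul_eq_zero.1 h2).resolve_right hu
  have hdim : Fintype.card κ = finrank ℝ (E →L[ℝ] ℝ) := by
    rw [hκ, ← LinearMap.toContinuousLinearMap.finrank_eq]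
    exact (Subspace.dual_finrank_eq (K := ℝ) (V := E)).symm
  have hspan := hli.span_eq_top_of_card_eq_finrank' hdim
  ext g
  obtain ⟨c, hc⟩ := (Submodule.mem_span_range_iff_exists_fun ℝ).1
    (hspan.symm ▸ Submodule.mem_top : differentialAt E y g ∈ _)
  have h1 : differentialAt E y (g - ∑ l, c l • x l) = 0 := by
    rw [map_sub, map_sum, ← hc]
    simp only [map_smul, sub_self]
  have h2 := derivation_eq_zero_of_mfderiv_eq_zero hδ h1
  simpa [map_sub, map_sum, hδx] using h2

end VectorFields

end AffineForms

/-! ### The bundle: local frames, gluing, and the vanishing statements -/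

namespace AffineForms

section Bundle

open Set Filter Topology Module

/-- A linear functional that vanishes on vertical vector fields, as a horizontal `1`-form. -/
def HForm.ofLin {A : Type*} [CommRing A] {D : Type*} [AddCommGroup D] [Module A D]
    {V : Submodule A D} (η : D →ₗ[A] A) (hη : ∀ Y ∈ V, η Y = 0) : HForm V 1 :=
  ⟨(AlternatingMap.ofSubsingleton A D A (0 : Fin 1) η : D [⋀^Fin 1]→ₗ[A] A), by
    intro s hs X hX
    obtain ⟨j, hj⟩ : s.Nonempty := by
      rw [← Finset.card_pos]; omega
    exact hη _ (hX 0 (by rwa [Subsingleton.elim (0 : Fin 1) j]))⟩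

variable {r m : ℕ}
  {M : Type*} [TopologicalSpace M] [ChartedSpace (EuclideanSpace ℝ (Fin (r + 1))) M]
  {P : Type*} [TopologicalSpace P] [ChartedSpace (EuclideanSpace ℝ (Fin (m + (r + 1)))) P]
  (α : C^∞⟮𝓡 (m + (r + 1)), P; 𝓡 (r + 1), M⟯)

/-- The horizontal `1`-form `d(f ∘ α)`. -/
noncomputable def pullbackDifferential (f : C^∞⟮𝓡 (r + 1), M; ℝ⟯) : HForm (vertical α) 1 :=
  HForm.ofLin { toFun := fun X => X (f.comp α), map_add' := fun _ _ => rfl,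
                map_smul' := fun _ _ => rfl } (fun _ hY => hY f)

/-- The derivation along `α` at a point which is given by a vector field. -/
noncomputable def derivationAlong (X : VectorFields r m P) (q : P) : C^∞⟮𝓡 (r + 1), M; ℝ⟯ →ₗ[ℝ] ℝ where
  toFun g := X (g.comp α) q
  map_add' f g := by
    rw [ContMDiffMap.add_comp, map_add]; rfl
  map_smul' a g := by
    rw [ContMDiffMap.smul_comp, Derivation.map_smul]; rfl

theorem derivationAlong_apply (X : VectorFields r m P) (q : P) (g : C^∞⟮𝓡 (r + 1), M; ℝ⟯) :
    derivationAlong α X q g = X (g.comp α) q := rfl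

theorem derivationAlong_mul (X : VectorFields r m P) (q : P) (f g : C^∞⟮𝓡 (r + 1), M; ℝ⟯) :
    derivationAlong α X q (f * g) =
      f (α q) * derivationAlong α X q g + g (α q) * derivationAlong α X q f := by
  rw [derivationAlong_apply, ContMDiffMap.mul_comp, Derivation.leibniz]
  rfl

variable {α} in
-- A local trivialization provides a smooth local section s through p; differentiating α ∘ s = id
-- shows that α is a submersion.
theorem IsSmoothFiberBundle.surjective_mfderiv {F : Type*} [TopologicalSpace F]
    [ChartedSpace (EuclideanSpace ℝ (Fin m)) F] (hα : IsSmoothFiberBundle F α) (p : P)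
    (v : EuclideanSpace ℝ (Fin (r + 1))) :
    ∃ u : EuclideanSpace ℝ (Fin (m + (r + 1))),
      (mfderiv (𝓡 (m + (r + 1))) (𝓡 (r + 1)) α p u : EuclideanSpace ℝ (Fin (r + 1))) = v := by
  obtain ⟨e, he, -, hsm⟩ := hα (α p)
  let s : M → P := fun x => e.toOpenPartialHomeomorph.symm (x, (e p).2)
  have hp : p ∈ e.source := e.mem_source.2 he
  have hep : e p = (α p, (e p).2) := Prod.ext (e.coe_fst hp) rfl
  have htgt : ((α p, (e p).2) : M × F) ∈ e.target := by
    rw [← hep]; exact e.map_source hp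
  have hsp : s (α p) = p := by
    change e.toOpenPartialHomeomorph.symm (α p, (e p).2) = p
    rw [← hep]
    exact e.left_inv hp
  have hs : ContMDiffAt (𝓡 (r + 1)) (𝓡 (m + (r + 1))) ∞ s (α p) :=
    ContMDiffAt.comp (α p)
      ((hsm _ htgt).contMDiffAt (e.open_target.mem_nhds htgt))
      (contMDiffAt_id.prodMk contMDiffAt_const)
  have hid : α ∘ s =ᶠ[𝓝 (α p)] id := by
    filter_upwards [e.open_baseSet.mem_nhds he] with x hx
    exact e.proj_symm_apply (e.mem_target.2 hx)
  have hα' : MDifferentiableAt (𝓡 (m + (r + 1))) (𝓡 (r + 1)) α (s (α p)) :=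
    α.contMDiff.mdifferentiableAt (by simp)
  have h := mfderiv_comp (α p) hα' (hs.mdifferentiableAt (by simp))
  rw [hid.mfderiv_eq, mfderiv_id, hsp] at h
  exact ⟨mfderiv (𝓡 (r + 1)) (𝓡 (m + (r + 1))) s (α p) v, (congrArg (fun L => L v) h).symm⟩

variable [T2Space M] [IsManifold (𝓡 (r + 1)) ∞ M]
  [T2Space P] [IsManifold (𝓡 (m + (r + 1))) ∞ P]

omit [T2Space P] [IsManifold (𝓡 (m + (r + 1))) ∞ P] in
/-- Vector fields `Z_i` with `Z_i(x_l ∘ α) = u δ_il` span the horizontal directions where `u` is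
invertible. -/
theorem smul_sub_sum_mem_vertical {x : Fin (r + 1) → C^∞⟮𝓡 (r + 1), M; ℝ⟯}
    {Z : Fin (r + 1) → VectorFields r m P} {u : SmoothFun r m P}
    (hZ : ∀ i l, Z i ((x l).comp α) = if i = l then u else 0) (X : VectorFields r m P) :
    u • (u • X - ∑ i, X ((x i).comp α) • Z i) ∈ vertical α := by
  set W : VectorFields r m P := u • X - ∑ i, X ((x i).comp α) • Z i with hWdef
  have hW : ∀ l, W ((x l).comp α) = 0 := fun l => by
    rw [hWdef, Derivation.sub_apply, derivation_sum_apply, Finset.sum_eq_single l]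
    · rw [Derivation.smul_apply, Derivation.smul_apply, hZ, if_pos rfl, smul_eq_mul, smul_eq_mul,
        mul_comm, sub_self]
    · intro i _ hi
      rw [Derivation.smul_apply, hZ, if_neg hi, smul_zero]
    · simp
  intro g
  ext q
  change u q * derivationAlong α W q g = 0
  -- Where u vanishes the Z i give no information about W; the extra factor u in the statement
  -- covers these points.
  by_cases hq : u q = 0
  · rw [hq, zero_mul]
  · have h0 : derivationAlong α W q = 0 :=
      derivation_eq_zero_of_frame (by simp) x (fun i => derivationAlong α (Z i) q)
        (fun i => derivationAlong_mul α (Z i) q) hq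
        (fun i l => by
          rw [derivationAlong_apply, hZ]
          split_ifs <;> rfl)
        (derivationAlong_mul α W q) (fun l => by
          rw [derivationAlong_apply, hW]
          rfl)
    rw [h0, LinearMap.zero_apply, mul_zero]

omit [T2Space M] [IsManifold (𝓡 (r + 1)) ∞ M] in
/-- Linear combinations of functions with injective differential are local coordinates. -/
theorem exists_differentialAt_sum_eq {ι : Type*} [Fintype ι] {f : ι → C^∞⟮𝓡 (r + 1), M; ℝ⟯} {y : M}
    (hf : ∀ v : EuclideanSpace ℝ (Fin (r + 1)), (∀ j, differentialAt _ y (f j) v = 0) → v = 0) :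
    ∃ c : Fin (r + 1) → ι → ℝ, ∀ i (v : EuclideanSpace ℝ (Fin (r + 1))),
      differentialAt _ y (∑ j, c i j • f j) v = v i := by
  classical
  let T := EuclideanSpace ℝ (Fin (r + 1))
  let df : T →ₗ[ℝ] (ι → ℝ) := LinearMap.pi fun j => (differentialAt T y (f j)).toLinearMap
  have hdf : LinearMap.ker df = ⊥ := by
    rw [LinearMap.ker_eq_bot']
    exact fun v hv => hf v (fun j => congrFun hv j)
  obtain ⟨C, hC⟩ := df.exists_leftInverse_of_injective hdf
  refine ⟨fun i j => C (Pi.single j 1) i, fun i v => ?_⟩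
  have h1 : C (df v) = v := congrArg (fun L => L v) hC
  have h2 : df v = ∑ j, df v j • Pi.single j (1 : ℝ) := by
    refine (Finset.univ_sum_single (df v)).symm.trans (Finset.sum_congr rfl fun j _ => ?_)
    rw [← Pi.single_smul, smul_eq_mul, mul_one]
  conv_rhs => rw [← h1, h2]
  rw [map_sum, map_sum]
  simp only [map_smul]
  rw [sum_apply, WithLp.ofLp_sum, Finset.sum_apply]
  exact Finset.sum_congr rfl (fun j _ => mul_comm _ _)

omit [T2Space M] [IsManifold (𝓡 (r + 1)) ∞ M] in
variable {α} in
/-- Local coordinates of the base have dual vector fields on the total space. -/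
theorem IsSmoothFiberBundle.exists_dual_vectorFields {F : Type*} [TopologicalSpace F]
    [ChartedSpace (EuclideanSpace ℝ (Fin m)) F] (hα : IsSmoothFiberBundle F α) (p : P)
    {x : Fin (r + 1) → C^∞⟮𝓡 (r + 1), M; ℝ⟯}
    (hx : ∀ i (v : EuclideanSpace ℝ (Fin (r + 1))), differentialAt _ (α p) (x i) v = v i) :
    ∃ (Z : Fin (r + 1) → VectorFields r m P) (u : SmoothFun r m P), u p ≠ 0 ∧
      ∀ i l, Z i ((x l).comp α) = if i = l then u else 0 := by
  choose u hu using fun i => hα.surjective_mfderiv p (EuclideanSpace.single i (1 : ℝ))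
  choose Y hY using fun i => exists_derivation_eq_mfderiv p (u i)
  let G : Matrix (Fin (r + 1)) (Fin (r + 1)) (SmoothFun r m P) :=
    Matrix.of fun i l => Y i ((x l).comp α)
  have hG : ∀ i l, G i l p = if i = l then 1 else 0 := fun i l => by
    change Y i ((x l).comp α) p = _
    rw [hY]
    have h1 := mfderiv_comp p (mdifferentiableAt_smoothMap (x l) (α p))
      (α.contMDiff.mdifferentiableAt (by simp))
    have h2 : differentialAt _ p ((x l).comp α) (u i) =
        differentialAt _ (α p) (x l) (EuclideanSpace.single i (1 : ℝ)) := by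
      rw [← hu i]
      exact congrArg (fun L => L (u i)) h1
    rw [h2, hx]
    simp [eq_comm]
  have hdet : G.det p = 1 := by
    have h1 := RingHom.map_det (ContMDiffMap.evalRingHom (I := 𝓡 (m + (r + 1)))
      (I' := 𝓘(ℝ, ℝ)) (n := ∞) p : SmoothFun r m P →+* ℝ) G
    refine h1.trans ?_
    have h2 : (ContMDiffMap.evalRingHom (I := 𝓡 (m + (r + 1)))
      (I' := 𝓘(ℝ, ℝ)) (n := ∞) p : SmoothFun r m P →+* ℝ).mapMatrix G = 1 := by
      ext i l
      rw [Matrix.one_apply]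
      exact hG i l
    rw [h2, Matrix.det_one]
  -- The lifted fields Y are dual to the coordinates only at p. Applying the adjugate of their
  -- Jacobian matrix makes the duality exact everywhere, with the determinant as common factor.
  refine ⟨fun i => ∑ k, G.adjugate i k • Y k, G.det, by rw [hdet]; exact one_ne_zero,
    fun i l => ?_⟩
  have h1 : (∑ k, G.adjugate i k • Y k) ((x l).comp α) = (G.adjugate * G) i l := by
    rw [Matrix.mul_apply]
    exact derivation_sum_apply _ _ _
  rw [h1, Matrix.adjugate_mul, Matrix.smul_apply, Matrix.one_apply]
  split_ifs <;> simp

variable {α} in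
/-- Local frames of horizontal vector fields, built from functions which define an immersion of
the base. -/
theorem IsSmoothFiberBundle.exists_localFrame {F : Type*} [TopologicalSpace F]
    [ChartedSpace (EuclideanSpace ℝ (Fin m)) F] (hα : IsSmoothFiberBundle F α)
    {ι : Type*} [Fintype ι] {f : ι → C^∞⟮𝓡 (r + 1), M; ℝ⟯}
    (hf : ∀ (y : M) (v : EuclideanSpace ℝ (Fin (r + 1))),
      (∀ j, differentialAt _ y (f j) v = 0) → v = 0) (p : P) :
    ∃ φ : LocalFrame (vertical α) (r + 1), φ.scale p ≠ 0 ∧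
      ∃ e : ι → VectorFields r m P, ∀ X : VectorFields r m P,
        ∑ i, HForm.toLin (vertical α) (φ.form i) X • φ.vec i =
          ∑ j, HForm.toLin (vertical α) (pullbackDifferential α (f j)) X • e j := by
  obtain ⟨c, hc⟩ := exists_differentialAt_sum_eq (hf (α p))
  obtain ⟨Z, u, hu, hZ⟩ := hα.exists_dual_vectorFields p hc
  -- The scale is u², since u • X minus its frame part is known to be vertical only after a further
  -- multiplication by u. The fields e j rewrite the frame part in terms of the global forms d(f j ∘
  -- α), as needed for gluing.
  refine ⟨⟨u * u, fun i => u • pullbackDifferential α (∑ j, c i j • f j), Z, fun X => ?_,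
    fun i j => ?_⟩, mul_ne_zero hu hu,
    fun j => ∑ i, (u * algebraMap ℝ (SmoothFun r m P) (c i j)) • Z i, fun X => ?_⟩
  · have h := smul_sub_sum_mem_vertical α hZ X
    rw [smul_sub, Finset.smul_sum, smul_smul] at h
    simp_rw [smul_smul] at h
    exact h
  · change u * Z j ((∑ l, c i l • f l).comp α) = _
    rw [hZ, mul_ite, mul_zero]
    simp only [eq_comm]
  · have hxα : ∀ i, (∑ j, c i j • f j).comp α = ∑ j, c i j • (f j).comp α := fun i => by
      ext q
      exact (smoothMap_sum_apply _ (fun j => c i j • f j) (α q)).trans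
        (smoothMap_sum_apply _ (fun j => c i j • (f j).comp α) q).symm
    have h1 : ∀ i, (u * X ((∑ j, c i j • f j).comp α)) • Z i =
        ∑ j, X ((f j).comp α) • (u * algebraMap ℝ (SmoothFun r m P) (c i j)) • Z i := fun i => by
      rw [hxα, map_sum, Finset.mul_sum, Finset.sum_smul]
      refine Finset.sum_congr rfl (fun j _ => ?_)
      rw [Derivation.map_smul, smul_smul, Algebra.smul_def]
      congr 1
      ring
    refine (Finset.sum_congr rfl fun i _ => h1 i).trans ?_
    rw [Finset.sum_comm]
    refine Finset.sum_congr rfl (fun j _ => ?_)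
    rw [Finset.smul_sum]
    rfl

omit [T2Space M] [IsManifold (𝓡 (r + 1)) ∞ M] in
/-- Local dual systems with the same horizontal forms can be glued. -/
theorem exists_horizontalSystem_of_local [SecondCountableTopology P] {ι : Type*} [Fintype ι]
    (η : ι → HForm (vertical α) 1)
    (h : ∀ p : P, ∃ a : SmoothFun r m P, a p ≠ 0 ∧ ∃ e : ι → VectorFields r m P,
      ∀ X : VectorFields r m P,
        a • X - ∑ j, HForm.toLin (vertical α) (η j) X • e j ∈ vertical α) :
    ∃ b : HorizontalSystem (vertical α) ι, b.form = η := by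
  have : LocallyCompactSpace P := Manifold.locallyCompact_of_finiteDimensional (𝓡 (m + (r + 1)))
  choose a ha e he using h
  obtain ⟨ρ, hρ⟩ := SmoothPartitionOfUnity.exists_isSubordinate (𝓡 (m + (r + 1)))
    (isClosed_univ (X := P)) (fun p => {q | a p q ≠ 0})
    (fun p => isOpen_ne_fun (a p).contMDiff.continuous continuous_const)
    (fun q _ => mem_iUnion.2 ⟨q, ha q⟩)
  have hsm : ∀ p, ContMDiff (𝓡 (m + (r + 1))) 𝓘(ℝ, ℝ) ∞ (fun q => ρ p q • (a p q)⁻¹) := fun p =>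
    ρ.contMDiff_smul (fun q hq => (a p).contMDiff.contMDiffAt.inv₀ (hρ p hq))
  -- Dividing the partition of unity by the local denominators gives ∑ c p * a p = 1. The glued
  -- fields are ∑ c p • e p j, with the forms η j left untouched.
  let c : P → SmoothFun r m P := fun p => ⟨_, hsm p⟩
  have hc : ∀ p q, c p q * a p q = ρ p q := fun p q => by
    change ρ p q * (a p q)⁻¹ * a p q = ρ p q
    by_cases hq : a p q = 0
    · have : ρ p q = 0 := by
        by_contra hne
        exact hρ p (subset_tsupport _ hne) hq
      simp [this]
    · rw [inv_mul_cancel_right₀ hq]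
  have hlf : LocallyFinite fun p => Function.support (c p) :=
    ρ.locallyFinite.subset (fun p q hq => left_ne_zero_of_mul hq)
  choose Y hY using fun j => exists_derivation_finsum hlf (fun p => e p j)
  refine ⟨⟨η, Y, fun X g => ?_⟩, rfl⟩
  ext q
  rw [Derivation.sub_apply, derivation_sum_apply]
  have e1 : (∑ j, (HForm.toLin (vertical α) (η j) X • Y j) (g.comp α)) q =
      ∑ j, HForm.toLin (vertical α) (η j) X q * Y j (g.comp α) q :=
    smoothMap_sum_apply _ _ _
  change X (g.comp α) q - (∑ j, (HForm.toLin (vertical α) (η j) X • Y j) (g.comp α)) q = 0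
  rw [e1]
  let s := (hlf.point_finite q).toFinset
  have hs : ∀ p, p ∉ s → c p q = 0 := fun p hp => by
    by_contra hne
    exact hp ((hlf.point_finite q).mem_toFinset.2 hne)
  have hone : ∑ p ∈ s, c p q * a p q = 1 := by
    rw [← ρ.sum_eq_one (mem_univ q), finsum_eq_sum_of_support_subset (s := s)]
    · exact Finset.sum_congr rfl fun p _ => hc p q
    · intro p hp
      by_contra hps
      refine hp ?_
      change ρ p q = 0
      rw [← hc, hs p hps, zero_mul]
  have hYs : ∀ j, Y j (g.comp α) q = ∑ p ∈ s, c p q * e p j (g.comp α) q := fun j => by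
    rw [hY, finsum_eq_sum_of_support_subset (s := s)]
    intro p hp
    by_contra hps
    exact hp (by simp only [hs p hps, zero_mul])
  have hloc : ∀ p, a p q * X (g.comp α) q =
      ∑ j, HForm.toLin (vertical α) (η j) X q * e p j (g.comp α) q := fun p => by
    have h1 := congrArg (fun u : SmoothFun r m P => u q) (he p X g)
    rw [Derivation.sub_apply, derivation_sum_apply] at h1
    have e2 : (∑ j, (HForm.toLin (vertical α) (η j) X • e p j) (g.comp α)) q =
        ∑ j, HForm.toLin (vertical α) (η j) X q * e p j (g.comp α) q :=
      smoothMap_sum_apply _ _ _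
    rw [← e2]
    exact sub_eq_zero.1 h1
  rw [sub_eq_zero, ← one_mul (X (g.comp α) q), ← hone, Finset.sum_mul]
  simp_rw [hYs, Finset.mul_sum]
  rw [Finset.sum_comm]
  refine Finset.sum_congr rfl (fun p _ => ?_)
  rw [mul_assoc, hloc, Finset.mul_sum]
  exact Finset.sum_congr rfl (fun j _ => by ring)

variable {α} in
/-- On a fiber bundle, horizontal forms have a global dual system, a horizontal form annihilated by
all wedge products with `1`-forms vanishes below the top degree, and forms which are more horizontal
than the dimension of the base allows vanish. -/
theorem IsSmoothFiberBundle.exists_horizontalSystem [SecondCountableTopology M]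
    [SecondCountableTopology P] {F : Type*} [TopologicalSpace F]
    [ChartedSpace (EuclideanSpace ℝ (Fin m)) F] (hα : IsSmoothFiberBundle F α) :
    Nonempty (HorizontalSystem (vertical α)
        (Fin 3 × Fin (2 * Module.finrank ℝ (EuclideanSpace ℝ (Fin (r + 1)))))) ∧
      (∀ ρ : HForm (vertical α) r, (∀ η, wedge (vertical α) r η ρ = 0) → ρ = 0) ∧
      ∀ {k : ℕ} {w : Form (SmoothFun r m P) (VectorFields r m P) k},
        w ∈ filtration (vertical α) (r + 2) k → w = 0 := by
  obtain ⟨f, hf⟩ := exists_immersion (E := EuclideanSpace ℝ (Fin (r + 1))) (M := M)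
  choose φ hφ e he using hα.exists_localFrame hf
  obtain ⟨b, -⟩ := exists_horizontalSystem_of_local α (fun j => pullbackDifferential α (f j))
    (fun p => ⟨(φ p).scale, hφ p, e p, fun X => he p X ▸ (φ p).sub_mem X⟩)
  -- Each scale is nonzero at its own base point, so its powers can be cancelled there.
  have hzero : ∀ (u : SmoothFun r m P) (k : P → ℕ), (∀ p, (φ p).scale ^ k p * u = 0) → u = 0 :=
    fun u k hu => by
      ext p
      have h : (φ p).scale p ^ k p * u p = 0 := congrArg (fun v : SmoothFun r m P => v p) (hu p)
      exact (mul_eq_zero.1 h).resolve_left (pow_ne_zero _ (hφ p))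
  exact ⟨⟨b⟩, fun ρ hρ => Subtype.ext (Form.ext fun X =>
      hzero _ _ (fun p => (φ p).pow_mul_apply_eq_zero_of_wedge hρ X)),
    fun hw => Form.ext fun X => hzero _ _ (fun p => (φ p).pow_mul_apply_eq_zero hw X)⟩

end Bundle

end AffineForms
theorem mainTheorem1 (r m : ℕ)
    (M : Type*) [TopologicalSpace M] [T2Space M] [SecondCountableTopology M]
    [ChartedSpace (EuclideanSpace ℝ (Fin (r + 1))) M] [IsManifold (𝓡 (r + 1)) ∞ M]
    (P : Type*) [TopologicalSpace P] [T2Space P] [SecondCountableTopology P]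
    [ChartedSpace (EuclideanSpace ℝ (Fin (m + (r + 1)))) P] [IsManifold (𝓡 (m + (r + 1))) ∞ P]
    (F : Type*) [TopologicalSpace F] [ChartedSpace (EuclideanSpace ℝ (Fin m)) F]
    [IsManifold (𝓡 m) ∞ F]
    (α : C^∞⟮𝓡 (m + (r + 1)), P; 𝓡 (r + 1), M⟯)
    (hα : IsSmoothFiberBundle F α) :
    -- the projection of affine forms onto their (unique) linear parts
    ∃ lin : ∀ q : ℕ, AffForm (vertical α) r q
        →ₗ[SmoothFun r m P] LinForm (vertical α) r q,
      (∀ q θ s, lin q θ = s ↔ IsLinPart (vertical α) r q θ s) ∧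
    -- the canonical isomorphisms
    ∃ ι₀ : ∀ q : ℕ, filtration (vertical α) (r + 1) (q + r)
        ≃ₗ[SmoothFun r m P] affForm0 (vertical α) r q,
    ∃ ι : ∀ q : ℕ, filtration (vertical α) r (q + r)
        ≃ₗ[SmoothFun r m P] AffForm (vertical α) r q,
    ∃ ιbar : ∀ q : ℕ, E0 (vertical α) r q
        ≃ₗ[SmoothFun r m P] LinForm (vertical α) r q,
      (∀ q w θ, ι₀ q w = θ ↔
        ZeroCorresponds (vertical α) r q w.1 θ.1) ∧
      (∀ q w θ, ι q w = θ ↔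
        AffCorresponds (vertical α) r q w.1 θ) ∧
      (∀ q (w : filtration (vertical α) r (q + r)) s,
        ιbar q (Submodule.Quotient.mk w) = s ↔
          LinCorresponds (vertical α) r q w.1 s) ∧
      -- the two squares commute
      (∀ q w, ι q (Submodule.inclusion
          (filtration_succ_le (vertical α) r (q + r)) w) =
        (ι₀ q w : AffForm (vertical α) r q)) ∧
      (∀ q (w : filtration (vertical α) r (q + r)),
        lin q (ι q w) = ιbar q (Submodule.Quotient.mk w)) ∧
      -- the rows are short exact sequences
      (∀ q : ℕ,
        Function.Injective (Submodule.inclusion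
          (filtration_succ_le (vertical α) r (q + r))) ∧
        Function.Exact
          (Submodule.inclusion
            (filtration_succ_le (vertical α) r (q + r)))
          ((filtration (vertical α) (r + 1) (q + r)).submoduleOf
            (filtration (vertical α) r (q + r))).mkQ ∧
        Function.Surjective
          ((filtration (vertical α) (r + 1) (q + r)).submoduleOf
            (filtration (vertical α) r (q + r))).mkQ) ∧
      (∀ q : ℕ,
        Function.Injective (affForm0 (vertical α) r q).subtype ∧
        Function.Exact (affForm0 (vertical α) r q).subtype (lin q) ∧
        Function.Surjective (lin q)) := by
  have h := hα.exists_horizontalSystem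
  refine h.1.some.exists_affineForm_isomorphisms (fun p => ?_) h.2.1 h.2.2
  -- Positive integers are units because smooth functions form an algebra over ℝ.
  rw [← map_natCast (algebraMap ℝ (SmoothFun r m P))]
  exact (Nat.cast_ne_zero.2 p.succ_ne_zero).isUnit.map _
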